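/- **Theorem (Möbius invariant subspaces of $X_\lambda(\mathbb D^2)$).** Let $\mathbb D$ be the open unit disk in $\mathbb C$ and $\mathbb D^2=\mathbb D\times\mathbb D$. For $\lambda\in\mathbb C$ let $X_\lambda(\mathbb D^2)$ be the complex vector space of all holomorphic functions $F:\mathbb D^2\to\mathbb C$ with $4(1-zw)^2\,\partial_z\partial_wF(z,w)=\lambda F(z,w)$ on $\mathbb D^2$, equipped with the topology of locally uniform convergence on $\mathbb D^2$. Call a closed linear subspace $Y\subseteq X_\lambda(\mathbb D^2)$ *Möbius invariant* if $F\circ T_\psi\in Y$ for every $F\in Y$ and every map $$T_\psi(z,w)=\left(\psi(z),\frac1{\psi(1/w)}\right),$$ where $\psi$ is a Möbius transformation of the Riemann sphere with $\psi(\mathbb D)=\mathbb D$. Call it *non-trivial* if $Y\neq\{0\}$ and $Y\neq X_\lambda(\mathbb D^2)$. For $\mu\in\mathbb C$ and $n\in\mathbb Z$ let $$P_n^\mu(z,w)=\frac{(1-zw)^\mu}{2\pi}\int_0^{2\pi}\frac{e^{-int}}{(1-ze^{-it})^\mu(1-we^{it})^\mu}\,dt,\qquad (z,w)\in\mathbb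 D^2,$$ with principal branches of the powers. * (NE) If $\lambda\neq4m(m+1)$ for all $m\in\mathbb N_0$, then $X_\lambda(\mathbb D^2)$ has no non-trivial Möbius invariant subspaces. * (E) If $\lambda=4m(m+1)$ for some $m\in\mathbb N_0$, then $X_\lambda(\mathbb D^2)$ has precisely three non-trivial Möbius invariant subspaces, namely $$X^+_\lambda=\overline{\operatorname{span}\{P_n^{m+1}:n\ge-m\}},\qquad X^-_\lambda=\overline{\operatorname{span}\{P_n^{m+1}:n\le m\}},\qquad X^0_\lambda=\operatorname{span}\{P_n^{m+1}:-m\le n\le m\},$$ where the bar denotes the closure with respect to locally uniform convergence on $\mathbb D^2$. Exactly one of them, $X^0_\lambda$, is finite dimensional; its dimension is $2m+1$. Moreover, under composition with the interchange $(z,w)\mapsto(w,z)$ the space $X^0_\lambda$ is invariant, while $X^+_\lambda$ and $X^-_\lambda$ are mapped onto each other. -/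

import Mathlib

open Metric Complex MeasureTheory

noncomputable section

/-- The bidisk `𝔻² = 𝔻 × 𝔻` as a subset of `ℂ²`. -/
def bidisk : Set (ℂ × ℂ) := ball (0 : ℂ) 1 ×ˢ ball (0 : ℂ) 1

theorem isOpen_bidisk : IsOpen bidisk := isOpen_ball.prod isOpen_ball

/-- Extension by zero of a function on the bidisk to `ℂ²`; it only serves to speak about
derivatives at the points of the open set `bidisk`. -/
def extZero (F : bidisk → ℂ) : ℂ × ℂ → ℂ := Function.extend Subtype.val F 0

theorem extZero_apply (F : bidisk → ℂ) (p : bidisk) : extZero F p.1 = F p :=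
  Subtype.val_injective.extend_apply F 0 p

/-- `F` is holomorphic on the bidisk. -/
def IsHolomorphic (F : bidisk → ℂ) : Prop := DifferentiableOn ℂ (extZero F) bidisk

/-- The invariant Laplacian `Δ_{zw} F(z,w) = 4 (1 - zw)² ∂_z ∂_w F(z,w)`. -/
def invLaplacian (F : ℂ × ℂ → ℂ) (p : ℂ × ℂ) : ℂ :=
  4 * (1 - p.1 * p.2) ^ 2 * deriv (fun z => deriv (fun w => F (z, w)) p.2) p.1

theorem extZero_add (F G : bidisk → ℂ) : extZero (F + G) = extZero F + extZero G := by
  funext p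
  by_cases h : p ∈ bidisk
  · simpa using (extZero_apply (F + G) ⟨p, h⟩).trans
      (congrArg₂ (· + ·) (extZero_apply F ⟨p, h⟩).symm (extZero_apply G ⟨p, h⟩).symm)
  · have hn : ¬ ∃ q : bidisk, q.1 = p := by rintro ⟨q, rfl⟩; exact h q.2
    simp [extZero, Function.extend_apply' _ _ _ hn]

theorem extZero_smul (c : ℂ) (F : bidisk → ℂ) : extZero (c • F) = c • extZero F := by
  funext p
  by_cases h : p ∈ bidisk
  · simpa using (extZero_apply (c • F) ⟨p, h⟩).trans
      (congrArg (c * ·) (extZero_apply F ⟨p, h⟩).symm)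
  · have hn : ¬ ∃ q : bidisk, q.1 = p := by rintro ⟨q, rfl⟩; exact h q.2
    simp [extZero, Function.extend_apply' _ _ _ hn]

theorem differentiableAt_slice_snd {F : ℂ × ℂ → ℂ} (hF : DifferentiableOn ℂ F bidisk)
    {z w : ℂ} (h : (z, w) ∈ bidisk) : DifferentiableAt ℂ (fun w' => F (z, w')) w := by
  have h1 : DifferentiableAt ℂ F (z, w) := hF.differentiableAt (isOpen_bidisk.mem_nhds h)
  exact DifferentiableAt.comp (f := fun w' : ℂ => ((z, w') : ℂ × ℂ)) w h1
    ((differentiableAt_const z).prodMk differentiableAt_id)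

theorem differentiableAt_slice_fst {F : ℂ × ℂ → ℂ} (hF : DifferentiableOn ℂ F bidisk)
    {z w : ℂ} (h : (z, w) ∈ bidisk) : DifferentiableAt ℂ (fun z' => F (z', w)) z := by
  have h1 : DifferentiableAt ℂ F (z, w) := hF.differentiableAt (isOpen_bidisk.mem_nhds h)
  exact DifferentiableAt.comp (f := fun z' : ℂ => ((z', w) : ℂ × ℂ)) z h1
    (differentiableAt_id.prodMk (differentiableAt_const w))

/-- The difference quotient of a bounded holomorphic function approximates its derivative with a
linear error. -/
theorem dist_dslope_le {f : ℂ → ℂ} {c x : ℂ} {r M : ℝ} (hM : 0 < M)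
    (hf : DifferentiableOn ℂ f (ball c r)) (hb : ∀ y ∈ ball c r, ‖f y‖ < M) (hx : x ∈ ball c r) :
    dist (dslope f c x) (deriv f c) ≤ (6 * M / r / r) * dist x c := by
  have hr : 0 < r := pos_of_mem_ball hx
  have hc : c ∈ ball c r := mem_ball_self hr
  have hmaps : Set.MapsTo f (ball c r) (ball (f c) (2 * M)) := by
    intro y hy
    rw [mem_ball, dist_eq_norm]
    calc ‖f y - f c‖ ≤ ‖f y‖ + ‖f c‖ := norm_sub_le _ _
      _ < 2 * M := by linarith [hb y hy, hb c hc]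
  have hbd : ∀ y ∈ ball c r, ‖dslope f c y‖ ≤ 2 * M / r := fun y hy =>
    Complex.norm_dslope_le_div_of_mapsTo_ball hf (hmaps.mono_right ball_subset_closedBall) hy
  have hd : DifferentiableOn ℂ (dslope f c) (ball c r) :=
    (Complex.differentiableOn_dslope (isOpen_ball.mem_nhds hc)).2 hf
  have hK : 0 < 2 * M / r := by positivity
  have hmaps2 : Set.MapsTo (dslope f c) (ball c r) (ball (dslope f c c) (6 * M / r)) := by
    intro y hy
    rw [mem_ball, dist_eq_norm]
    calc ‖dslope f c y - dslope f c c‖ ≤ ‖dslope f c y‖ + ‖dslope f c c‖ := norm_sub_le _ _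
      _ ≤ 2 * M / r + 2 * M / r := add_le_add (hbd y hy) (hbd c hc)
      _ < 6 * M / r := by
        have : 6 * M / r = 3 * (2 * M / r) := by ring
        linarith
  have := Complex.dist_le_div_mul_dist_of_mapsTo_ball hd
    (hmaps2.mono_right ball_subset_closedBall) hx
  rwa [dslope_same] at this

/-- For holomorphic `F`, the derivative `∂_w F` is holomorphic in `z`. -/
theorem differentiableAt_deriv_snd {F : ℂ × ℂ → ℂ} (hF : DifferentiableOn ℂ F bidisk)
    {z₀ w₀ : ℂ} (h : (z₀, w₀) ∈ bidisk) :
    DifferentiableAt ℂ (fun z => deriv (fun w => F (z, w)) w₀) z₀ := by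
  have hcont : ContinuousAt F (z₀, w₀) :=
    (hF.differentiableAt (isOpen_bidisk.mem_nhds h)).continuousAt
  have hM : (0 : ℝ) < ‖F (z₀, w₀)‖ + 1 := by positivity
  obtain ⟨r, hr, hball⟩ : ∃ r > 0, ball ((z₀, w₀) : ℂ × ℂ) r ⊆
      {p | ‖F p‖ < ‖F (z₀, w₀)‖ + 1} ∩ bidisk := by
    apply Metric.mem_nhds_iff.1
    exact Filter.inter_mem (hcont.norm.eventually_lt continuousAt_const (lt_add_one _))
      (isOpen_bidisk.mem_nhds h)
  rw [← ball_prod_same] at hball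
  set M := ‖F (z₀, w₀)‖ + 1
  let ε : ℕ → ℂ := fun n => ((r / (n + 2) : ℝ) : ℂ)
  have hεpos : ∀ n : ℕ, 0 < r / ((n : ℝ) + 2) := fun n => by positivity
  have hε0 : ∀ n, ε n ≠ 0 := fun n => by
    simpa [ε] using (ofReal_ne_zero.2 (hεpos n).ne')
  have hεr : ∀ n, w₀ + ε n ∈ ball w₀ r := fun n => by
    rw [mem_ball, dist_eq_norm, add_sub_cancel_left, norm_real, Real.norm_of_nonneg (hεpos n).le]
    rw [div_lt_iff₀ (by positivity)]
    nlinarith [(Nat.cast_nonneg n : (0 : ℝ) ≤ n)]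
  have hlim : TendstoLocallyUniformlyOn
      (fun n z => dslope (fun w => F (z, w)) w₀ (w₀ + ε n))
      (fun z => deriv (fun w => F (z, w)) w₀) Filter.atTop (ball z₀ r) := by
    apply TendstoUniformlyOn.tendstoLocallyUniformlyOn
    rw [Metric.tendstoUniformlyOn_iff]
    intro δ hδ
    have ht : Filter.Tendsto (fun n : ℕ => (6 * M / r / r) * (r / ((n : ℝ) + 2)))
        Filter.atTop (nhds 0) := by
      have h1 : Filter.Tendsto (fun n : ℕ => r / ((n : ℝ) + 2)) Filter.atTop (nhds 0) :=
        tendsto_const_nhds.div_atTop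
          (Filter.tendsto_atTop_add_const_right _ _ tendsto_natCast_atTop_atTop)
      simpa using h1.const_mul (6 * M / r / r)
    filter_upwards [ht.eventually (gt_mem_nhds hδ)] with n hn z hz
    rw [dist_comm]
    refine lt_of_le_of_lt (dist_dslope_le hM (r := r) ?_ ?_ (hεr n)) ?_
    · intro w hw
      exact (differentiableAt_slice_snd hF (hball ⟨hz, hw⟩).2).differentiableWithinAt
    · intro w hw
      exact (hball ⟨hz, hw⟩).1
    · rw [dist_eq_norm, add_sub_cancel_left, norm_real, Real.norm_of_nonneg (hεpos n).le]
      exact hn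
  have hdiff := hlim.differentiableOn (Filter.Eventually.of_forall fun n => ?_) isOpen_ball
  · exact hdiff.differentiableAt (isOpen_ball.mem_nhds (mem_ball_self hr))
  · have heq : (fun z => dslope (fun w => F (z, w)) w₀ (w₀ + ε n)) =
        fun z => (ε n)⁻¹ * (F (z, w₀ + ε n) - F (z, w₀)) := by
      funext z
      rw [dslope_of_ne _ (by simpa using hε0 n), slope_def_field, add_sub_cancel_left]
      ring
    rw [heq]
    intro z hz
    exact (((differentiableAt_slice_fst hF (hball ⟨hz, hεr n⟩).2).sub
      (differentiableAt_slice_fst hF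
        (hball ⟨hz, mem_ball_self hr⟩).2)).const_mul _).differentiableWithinAt

theorem invLaplacian_add {F G : ℂ × ℂ → ℂ} (hF : DifferentiableOn ℂ F bidisk)
    (hG : DifferentiableOn ℂ G bidisk) {p : ℂ × ℂ} (hp : p ∈ bidisk) :
    invLaplacian (F + G) p = invLaplacian F p + invLaplacian G p := by
  obtain ⟨z, w⟩ := p
  have hev : (fun z' => deriv (fun w' => (F + G) (z', w')) w) =ᶠ[nhds z]
      (fun z' => deriv (fun w' => F (z', w')) w) + fun z' => deriv (fun w' => G (z', w')) w := by
    filter_upwards [isOpen_ball.mem_nhds hp.1] with z' hz'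
    exact deriv_add (differentiableAt_slice_snd hF ⟨hz', hp.2⟩)
      (differentiableAt_slice_snd hG ⟨hz', hp.2⟩)
  simp only [invLaplacian]
  rw [hev.deriv_eq, deriv_add (differentiableAt_deriv_snd hF hp)
    (differentiableAt_deriv_snd hG hp)]
  ring

theorem invLaplacian_smul (c : ℂ) (F : ℂ × ℂ → ℂ) (p : ℂ × ℂ) :
    invLaplacian (c • F) p = c * invLaplacian F p := by
  simp only [invLaplacian, Pi.smul_apply, smul_eq_mul, deriv_const_mul_field']
  ring

theorem invLaplacian_zero (p : ℂ × ℂ) : invLaplacian 0 p = 0 := by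
  simp [invLaplacian]

/-- The eigenspace `X_λ(𝔻²)` of all holomorphic `F` on the bidisk with `Δ_{zw} F = λ F`, as a
subspace of the space `C(𝔻², ℂ)` with its compact-open topology (locally uniform convergence).
Since locally uniform limits of holomorphic functions are holomorphic, for subspaces of `X_λ(𝔻²)`
closures in `C(𝔻², ℂ)` and in the space of holomorphic functions on `𝔻²` agree. -/
def eigenspace (lam : ℂ) : Submodule ℂ C(bidisk, ℂ) where
  carrier := {F | IsHolomorphic F ∧ ∀ p : bidisk, invLaplacian (extZero F) p = lam * F p}
  zero_mem' := by
    have h0 : extZero ((0 : C(bidisk, ℂ)) : bidisk → ℂ) = 0 := by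
      simpa using extZero_smul 0 (0 : bidisk → ℂ)
    refine ⟨?_, fun p => ?_⟩
    · rw [IsHolomorphic, h0]
      exact differentiableOn_const 0
    · rw [h0, invLaplacian_zero]
      simp
  add_mem' := by
    rintro F G ⟨hF, hF'⟩ ⟨hG, hG'⟩
    have h : extZero ((F + G : C(bidisk, ℂ)) : bidisk → ℂ) = extZero F + extZero G :=
      extZero_add F G
    refine ⟨?_, fun p => ?_⟩
    · rw [IsHolomorphic, h]
      exact DifferentiableOn.add hF hG
    · rw [h, invLaplacian_add hF hG p.2, hF', hG', ContinuousMap.add_apply, mul_add]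
  smul_mem' := by
    rintro c F ⟨hF, hF'⟩
    have h : extZero ((c • F : C(bidisk, ℂ)) : bidisk → ℂ) = c • extZero F := extZero_smul c F
    refine ⟨?_, fun p => ?_⟩
    · rw [IsHolomorphic, h]
      exact DifferentiableOn.const_smul hF c
    · rw [h, invLaplacian_smul, hF', ContinuousMap.smul_apply, smul_eq_mul]
      ring

/-- The unit disk as a subset of the Riemann sphere `ℂ ∪ {∞}`. -/
def diskInSphere : Set (OnePoint ℂ) := (fun z : ℂ => (z : OnePoint ℂ)) '' ball (0 : ℂ) 1

/-- The matrix of the Möbius transformation `x ↦ 1 / x` of the Riemann sphere. -/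
def invMatrix : GL (Fin 2) ℂ := Matrix.GeneralLinearGroup.mkOfDetNeZero !![0, 1; 1, 0] (by simp)

/-- `T` is the map `(z, w) ↦ (ψ(z), 1 / ψ(1 / w))` for a Möbius transformation `ψ` of the Riemann
sphere (given by `g`) that maps the unit disk onto itself. -/
def IsMoebius (T : C(bidisk, bidisk)) : Prop :=
  ∃ g : GL (Fin 2) ℂ, (fun x : OnePoint ℂ => g • x) '' diskInSphere = diskInSphere ∧
    ∀ p : bidisk, ((T p).1.1 : OnePoint ℂ) = g • (p.1.1 : OnePoint ℂ) ∧
      ((T p).1.2 : OnePoint ℂ) = invMatrix • g • invMatrix • (p.1.2 : OnePoint ℂ)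

/-- `Y` is a Möbius invariant subspace of `X_λ(𝔻²)`: a closed linear subspace that is
invariant under composition with the maps `(z, w) ↦ (ψ(z), 1 / ψ(1 / w))`, where `ψ` runs through
the Möbius group of the unit disk. -/
structure IsMoebiusInvariant (lam : ℂ) (Y : Submodule ℂ C(bidisk, ℂ)) : Prop where
  le_eigenspace : Y ≤ eigenspace lam
  isClosed : IsClosed (Y : Set C(bidisk, ℂ))
  comp_mem : ∀ T : C(bidisk, bidisk), IsMoebius T → ∀ F ∈ Y, F.comp T ∈ Y

/-- The non-trivial Möbius invariant subspaces of `X_λ(𝔻²)`. -/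
def nontrivialInvariantSubspaces (lam : ℂ) : Set (Submodule ℂ C(bidisk, ℂ)) :=
  {Y | IsMoebiusInvariant lam Y ∧ Y ≠ ⊥ ∧ Y ≠ eigenspace lam}

/-- The interchange `(z, w) ↦ (w, z)` of the two coordinates. -/
def bidiskSwap : C(bidisk, bidisk) where
  toFun p := ⟨(p.1.2, p.1.1), p.2.2, p.2.1⟩
  continuous_toFun := by fun_prop

/-- The Poisson Fourier mode
`P_n^μ(z,w) = (1-zw)^μ / (2π) ∫₀^{2π} e^{-int} / ((1 - z e^{-it})^μ (1 - w e^{it})^μ) dt`,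
with principal branches of the powers. -/
def pfmFun (μ : ℂ) (n : ℤ) (p : ℂ × ℂ) : ℂ :=
  (1 - p.1 * p.2) ^ μ / (2 * Real.pi) *
    ∫ t in (0 : ℝ)..(2 * Real.pi), exp (-(I * n * t)) /
      ((1 - p.1 * exp (-(I * t))) ^ μ * (1 - p.2 * exp (I * t)) ^ μ)

theorem one_sub_mem_slitPlane {x : ℂ} (hx : ‖x‖ < 1) : 1 - x ∈ slitPlane := by
  left
  rw [sub_re, one_re]
  linarith [re_le_norm x]

theorem norm_mul_exp_lt {x : ℂ} (hx : x ∈ ball (0 : ℂ) 1) {s : ℂ} (hs : s.re = 0) :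
    ‖x * exp s‖ < 1 := by
  rw [norm_mul, norm_exp, hs, Real.exp_zero, mul_one]
  simpa using hx

theorem continuous_pfmFun (μ : ℂ) (n : ℤ) : Continuous fun p : bidisk => pfmFun μ n p := by
  unfold pfmFun
  have h1 : ∀ q : bidisk × ℝ, 1 - q.1.1.1 * exp (-(I * q.2)) ∈ slitPlane := fun q =>
    one_sub_mem_slitPlane (norm_mul_exp_lt q.1.2.1 (by simp))
  have h2 : ∀ q : bidisk × ℝ, 1 - q.1.1.2 * exp (I * q.2) ∈ slitPlane := fun q =>
    one_sub_mem_slitPlane (norm_mul_exp_lt q.1.2.2 (by simp))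
  have h3 : ∀ p : bidisk, 1 - p.1.1 * p.1.2 ∈ slitPlane := fun p => by
    apply one_sub_mem_slitPlane
    rw [norm_mul]
    have ha : ‖p.1.1‖ < 1 := by simpa using p.2.1
    have hb : ‖p.1.2‖ < 1 := by simpa using p.2.2
    nlinarith [norm_nonneg p.1.1, norm_nonneg p.1.2]
  refine Continuous.mul ?_ ?_
  · exact (Continuous.cpow (by fun_prop) continuous_const h3).div_const _
  · apply intervalIntegral.continuous_parametric_intervalIntegral_of_continuous'
    refine Continuous.div (by fun_prop) (Continuous.mul ?_ ?_) ?_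
    · exact Continuous.cpow (by fun_prop) continuous_const h1
    · exact Continuous.cpow (by fun_prop) continuous_const h2
    · intro q
      refine mul_ne_zero ?_ ?_
      · exact fun h => slitPlane_ne_zero (h1 q) ((cpow_eq_zero_iff _ _).1 h).1
      · exact fun h => slitPlane_ne_zero (h2 q) ((cpow_eq_zero_iff _ _).1 h).1

/-- The Poisson Fourier mode `P_n^μ` as a continuous function on the bidisk. -/
def pfm (μ : ℂ) (n : ℤ) : C(bidisk, ℂ) := ⟨fun p => pfmFun μ n p, continuous_pfmFun μ n⟩

/-- The closure of `span {P_n^{m+1} : n ≥ -m}`. -/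
def Xplus (m : ℕ) : Submodule ℂ C(bidisk, ℂ) :=
  (Submodule.span ℂ {F | ∃ n : ℤ, -(m : ℤ) ≤ n ∧ F = pfm (m + 1) n}).topologicalClosure

/-- The closure of `span {P_n^{m+1} : n ≤ m}`. -/
def Xminus (m : ℕ) : Submodule ℂ C(bidisk, ℂ) :=
  (Submodule.span ℂ {F | ∃ n : ℤ, n ≤ (m : ℤ) ∧ F = pfm (m + 1) n}).topologicalClosure

/-- `span {P_n^{m+1} : -m ≤ n ≤ m}`. -/
def Xzero (m : ℕ) : Submodule ℂ C(bidisk, ℂ) :=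
  Submodule.span ℂ {F | ∃ n : ℤ, -(m : ℤ) ≤ n ∧ n ≤ (m : ℤ) ∧ F = pfm (m + 1) n}

end

/-!
The eigenfunctions of the invariant Laplacian are expanded in double power series
`F = ∑ a (j, k) z ^ j w ^ k` (`HasCoeffs`, `exists_hasCoeffs`). The eigenvalue equation becomes the
recurrence `EigenCoeffs`, which only relates coefficients with the same degree `j - k`. It is
solved uniquely from the boundary coefficients `bd a n`, those of `z ^ n` (`n ≥ 0`) and
`w ^ (-n)` (`n ≤ 0`), see `EigenCoeffs.eq_zero`. So for every degree `n ∈ ℤ` there is at most a line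
of homogeneous eigenfunctions ("modes", `IsMode`).

Rotations act on the modes by characters. By averaging over roots of unity, a closed rotation
invariant space `Y` contains the homogeneous components of its elements (`component_mem`), so it
consists of all eigenfunctions with degrees in `modeSet Y`: `Y = modeSpace lam (modeSet Y)`
(`eq_modeSpace`). Invariance under the hyperbolic translations gives invariance under their
generator `(z² - 1) ∂_z + (w² - 1) ∂_w` (`lie_mem`), which maps a mode of degree `n` to a sum of
modes of degrees `n ± 1`. Towards degree `0` the factor never vanishes (`bd_lieCoeffs_pred`), and
away from it the factor from `±n` to `±(n + 1)` vanishes only for `λ = 4 n (n + 1)`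
(`bd_lieCoeffs_succ`). Hence `modeSet Y` is empty or `ℤ`, or `λ = 4 m (m + 1)` and it is one of
`n ≤ m`, `n ≥ -m`, `-m ≤ n ≤ m` (`modeSet_eq_univ`, `modeSet_cases`).

It remains to see that these three sets of degrees do give invariant spaces for
`λ = 4 m (m + 1)`. The condition that `(1 - zw)^m F(z, w)` is a polynomial of degree at most `m`
in `z` for every `w` is closed and Möbius invariant (`growthSpace`), because
`1 - zw` is multiplied by a function of `z` times a function of `w` under a Möbius map
(`one_sub_mul_fractional`). It excludes the degrees `n > m`, and it is satisfied by the
eigenfunction `e^w p(z / (1 - zw))` with `p` a Bessel polynomial, which has all degrees `n ≤ 0`.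
The classification above then forces the eigenfunctions with this property to be exactly those of
degrees `n ≤ m` (`modeSpace_Iic_eq`). The other two sets follow by interchanging `z` and `w` and by
intersection.

Finally, `P_n^{m+1}` is the component of degree `-n` of the Poisson kernel
`((1 - zw) / ((1 - z)(1 - w)))^(m + 1)`, all of whose boundary coefficients are non-zero
(`hasCoeffs_pfm`, `bd_poissonMap_ne_zero`); so it is a mode of degree `-n`, and `Xplus m`,
`Xminus m`, `Xzero m` are the spaces with degrees `n ≤ m`, `n ≥ -m`, `-m ≤ n ≤ m`.
-/

noncomputable section

/-! ### Double power series on the bidisk -/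

/-- The double power series with coefficients `a (j, k)` converges absolutely on the bidisk. -/
def AbsConv (a : ℕ × ℕ → ℂ) : Prop :=
  ∀ r : ℝ, 0 ≤ r → r < 1 → Summable fun i => ‖a i‖ * r ^ (i.1 + i.2)

/-- The sum `∑ a (j, k) z ^ j w ^ k` of a double power series (zero where it is not summable). -/
def ev (a : ℕ × ℕ → ℂ) (p : ℂ × ℂ) : ℂ := ∑' i : ℕ × ℕ, a i * (p.1 ^ i.1 * p.2 ^ i.2)

/-- Coefficients of `z` times a double power series. -/
def mulFst (a : ℕ × ℕ → ℂ) : ℕ × ℕ → ℂ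
  | (0, _) => 0
  | (j + 1, k) => a (j, k)

/-- Coefficients of `w` times a double power series. -/
def mulSnd (a : ℕ × ℕ → ℂ) : ℕ × ℕ → ℂ
  | (_, 0) => 0
  | (j, k + 1) => a (j, k)

/-- Coefficients of the derivative of a double power series with respect to `z`. -/
def derFst (a : ℕ × ℕ → ℂ) : ℕ × ℕ → ℂ := fun i => (i.1 + 1) * a (i.1 + 1, i.2)

/-- Coefficients of the derivative of a double power series with respect to `w`. -/
def derSnd (a : ℕ × ℕ → ℂ) : ℕ × ℕ → ℂ := fun i => (i.2 + 1) * a (i.1, i.2 + 1)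

theorem mem_bidisk {z w : ℂ} : (z, w) ∈ bidisk ↔ ‖z‖ < 1 ∧ ‖w‖ < 1 := by
  simp [bidisk]

theorem swap_mem_bidisk {p : ℂ × ℂ} (hp : p ∈ bidisk) : p.swap ∈ bidisk := ⟨hp.2, hp.1⟩

theorem norm_monomial_le (c : ℂ) {p : ℂ × ℂ} {r : ℝ} (h1 : ‖p.1‖ ≤ r) (h2 : ‖p.2‖ ≤ r)
    (i : ℕ × ℕ) : ‖c * (p.1 ^ i.1 * p.2 ^ i.2)‖ ≤ ‖c‖ * r ^ (i.1 + i.2) := by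
  have hr : 0 ≤ r := (norm_nonneg _).trans h1
  rw [norm_mul, norm_mul, norm_pow, norm_pow, pow_add]
  gcongr

theorem exists_radius {p : ℂ × ℂ} (hp : p ∈ bidisk) :
    ∃ r : ℝ, 0 < r ∧ r < 1 ∧ ‖p.1‖ < r ∧ ‖p.2‖ < r := by
  obtain ⟨z, w⟩ := p
  obtain ⟨hz, hw⟩ := mem_bidisk.1 hp
  obtain ⟨r, hr1, hr2⟩ := exists_between (max_lt hz hw)
  exact ⟨r, (norm_nonneg z).trans_lt ((le_max_left _ _).trans_lt hr1), hr2,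
    (le_max_left _ _).trans_lt hr1, (le_max_right _ _).trans_lt hr1⟩

namespace AbsConv

variable {a b : ℕ × ℕ → ℂ}

theorem summable (ha : AbsConv a) {p : ℂ × ℂ} (hp : p ∈ bidisk) :
    Summable fun i : ℕ × ℕ => a i * (p.1 ^ i.1 * p.2 ^ i.2) := by
  obtain ⟨r, hr0, hr1, h1, h2⟩ := exists_radius hp
  exact (ha r hr0.le hr1).of_norm_bounded fun i => norm_monomial_le _ h1.le h2.le i

theorem hasSum (ha : AbsConv a) {p : ℂ × ℂ} (hp : p ∈ bidisk) :
    HasSum (fun i : ℕ × ℕ => a i * (p.1 ^ i.1 * p.2 ^ i.2)) (ev a p) :=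
  (ha.summable hp).hasSum

theorem mono (ha : AbsConv a) (h : ∀ i, ‖b i‖ ≤ ‖a i‖) : AbsConv b := fun r h0 h1 =>
  (ha r h0 h1).of_nonneg_of_le (fun i => by positivity) fun i => by gcongr; exact h i

theorem add (ha : AbsConv a) (hb : AbsConv b) : AbsConv (a + b) := fun r h0 h1 =>
  ((ha r h0 h1).add (hb r h0 h1)).of_nonneg_of_le (fun i => by positivity) fun i => by
    rw [← add_mul]
    gcongr
    exact norm_add_le _ _

theorem smul (c : ℂ) (ha : AbsConv a) : AbsConv (c • a) := fun r h0 h1 => by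
  simpa [mul_assoc] using (ha r h0 h1).mul_left ‖c‖

theorem sub (ha : AbsConv a) (hb : AbsConv b) : AbsConv (a - b) := by
  have := ha.add (hb.smul (-1))
  rwa [neg_one_smul, ← sub_eq_add_neg] at this

theorem swap (ha : AbsConv a) : AbsConv (a ∘ Prod.swap) := fun r h0 h1 => by
  simpa [Function.comp_def, add_comm] using (ha r h0 h1).comp_injective Prod.swap_injective

end AbsConv

theorem absConv_zero : AbsConv 0 := fun r _ _ => by simp

theorem ev_add {a b : ℕ × ℕ → ℂ} (ha : AbsConv a) (hb : AbsConv b) {p : ℂ × ℂ}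
    (hp : p ∈ bidisk) : ev (a + b) p = ev a p + ev b p := by
  refine HasSum.tsum_eq ?_
  simpa [add_mul] using (ha.hasSum hp).add (hb.hasSum hp)

theorem ev_smul (c : ℂ) (a : ℕ × ℕ → ℂ) (p : ℂ × ℂ) : ev (c • a) p = c * ev a p := by
  simp only [ev, Pi.smul_apply, smul_eq_mul, mul_assoc, tsum_mul_left]

theorem ev_sub {a b : ℕ × ℕ → ℂ} (ha : AbsConv a) (hb : AbsConv b) {p : ℂ × ℂ}
    (hp : p ∈ bidisk) : ev (a - b) p = ev a p - ev b p := by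
  refine HasSum.tsum_eq ?_
  simpa [sub_mul] using (ha.hasSum hp).sub (hb.hasSum hp)

theorem ev_zero (p : ℂ × ℂ) : ev 0 p = 0 := by simp [ev]

theorem ev_swap (a : ℕ × ℕ → ℂ) (p : ℂ × ℂ) : ev (a ∘ Prod.swap) p = ev a p.swap := by
  unfold ev
  rw [← (Equiv.prodComm ℕ ℕ).tsum_eq]
  refine tsum_congr fun i => ?_
  simp [mul_comm]

theorem mulSnd_eq (a : ℕ × ℕ → ℂ) : mulSnd a = mulFst (a ∘ Prod.swap) ∘ Prod.swap := by
  funext ⟨j, k⟩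
  cases k <;> rfl

theorem derSnd_eq (a : ℕ × ℕ → ℂ) : derSnd a = derFst (a ∘ Prod.swap) ∘ Prod.swap := rfl

theorem hasSum_succ_fst {E : Type*} [AddCommMonoid E] [TopologicalSpace E]
    {f : ℕ × ℕ → E} {s : E} (h0 : ∀ k, f (0, k) = 0) :
    HasSum (fun i : ℕ × ℕ => f (i.1 + 1, i.2)) s ↔ HasSum f s := by
  have hinj : Function.Injective fun i : ℕ × ℕ => (i.1 + 1, i.2) := by
    rintro ⟨j, k⟩ ⟨j', k'⟩ h
    simpa using h
  refine hinj.hasSum_iff (f := f) ?_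
  rintro ⟨j, k⟩ hx
  cases j with
  | zero => exact h0 k
  | succ j => exact absurd ⟨(j, k), rfl⟩ hx

theorem AbsConv.mulFst {a : ℕ × ℕ → ℂ} (ha : AbsConv a) : AbsConv (mulFst a) := fun r h0 h1 => by
  have hs := ((ha r h0 h1).mul_left r).hasSum
  refine ((hasSum_succ_fst (f := fun i => ‖_root_.mulFst a i‖ * r ^ (i.1 + i.2))
    (fun k => by simp [_root_.mulFst])).1 (hs.congr_fun fun i => ?_)).summable
  simp only [_root_.mulFst]
  ring

theorem ev_mulFst {a : ℕ × ℕ → ℂ} (ha : AbsConv a) {p : ℂ × ℂ} (hp : p ∈ bidisk) :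
    ev (mulFst a) p = p.1 * ev a p := by
  refine HasSum.tsum_eq ((hasSum_succ_fst (fun k => by simp [mulFst])).1
    (((ha.hasSum hp).mul_left p.1).congr_fun fun i => ?_))
  simp only [mulFst]
  ring

theorem AbsConv.mulSnd {a : ℕ × ℕ → ℂ} (ha : AbsConv a) : AbsConv (mulSnd a) := by
  rw [mulSnd_eq]
  exact ha.swap.mulFst.swap

theorem ev_mulSnd {a : ℕ × ℕ → ℂ} (ha : AbsConv a) {p : ℂ × ℂ} (hp : p ∈ bidisk) :
    ev (mulSnd a) p = p.2 * ev a p := by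
  rw [mulSnd_eq, ev_swap, ev_mulFst ha.swap (swap_mem_bidisk hp), ev_swap]
  simp

theorem hasSum_derFst {a : ℕ × ℕ → ℂ} (ha : AbsConv a) {z w : ℂ} (hp : (z, w) ∈ bidisk) :
    HasDerivAt (fun z => ev a (z, w)) (deriv (fun z => ev a (z, w)) z) z ∧
      HasSum (fun i => derFst a i * (z ^ i.1 * w ^ i.2)) (deriv (fun z => ev a (z, w)) z) := by
  obtain ⟨r, hr0, hr1, h1, h2⟩ := exists_radius hp
  have hd : ∀ i : ℕ × ℕ, DifferentiableOn ℂ (fun z : ℂ => a i * (z ^ i.1 * w ^ i.2))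
      (ball 0 r) := fun i => by fun_prop
  have hb : ∀ (i : ℕ × ℕ) (z : ℂ), z ∈ ball (0 : ℂ) r →
      ‖a i * (z ^ i.1 * w ^ i.2)‖ ≤ ‖a i‖ * r ^ (i.1 + i.2) := fun i z hz =>
    norm_monomial_le (p := (z, w)) _ (by simpa using (mem_ball_zero_iff.1 hz).le) h2.le i
  have hz : z ∈ ball (0 : ℂ) r := by simpa using h1
  have hdiff := differentiableOn_tsum_of_summable_norm (ha r hr0.le hr1) hd isOpen_ball hb
  refine ⟨(hdiff.differentiableAt (isOpen_ball.mem_nhds hz)).hasDerivAt, ?_⟩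
  have hs := hasSum_deriv_of_summable_norm (ha r hr0.le hr1) hd isOpen_ball hb hz
  have hterm : ∀ i : ℕ × ℕ, deriv (fun z : ℂ => a i * (z ^ i.1 * w ^ i.2)) z =
      a i * (i.1 * z ^ (i.1 - 1) * w ^ i.2) := fun i => by
    simp
  simp only [hterm] at hs
  change HasSum _ (deriv (fun z => ev a (z, w)) z) at hs
  refine ((hasSum_succ_fst (fun k => by simp)).2 hs).congr_fun fun i => ?_
  simp only [derFst, Nat.cast_add, Nat.cast_one, Nat.add_sub_cancel]
  ring

theorem AbsConv.derFst {a : ℕ × ℕ → ℂ} (ha : AbsConv a) : AbsConv (derFst a) := fun r h0 h1 => by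
  have hp : ((r : ℂ), (r : ℂ)) ∈ bidisk := by
    rw [mem_bidisk]
    simp [abs_of_nonneg h0, h1]
  refine (hasSum_derFst ha hp).2.summable.norm.congr fun i => ?_
  simp [pow_add, abs_of_nonneg h0]

theorem hasDerivAt_ev_fst {a : ℕ × ℕ → ℂ} (ha : AbsConv a) {z w : ℂ} (hp : (z, w) ∈ bidisk) :
    HasDerivAt (fun z => ev a (z, w)) (ev (derFst a) (z, w)) z := by
  have h := hasSum_derFst ha hp
  rw [show ev (derFst a) (z, w) = _ from h.2.tsum_eq]
  exact h.1

theorem AbsConv.derSnd {a : ℕ × ℕ → ℂ} (ha : AbsConv a) : AbsConv (derSnd a) := by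
  rw [derSnd_eq]
  exact ha.swap.derFst.swap

theorem hasDerivAt_ev_snd {a : ℕ × ℕ → ℂ} (ha : AbsConv a) {z w : ℂ} (hp : (z, w) ∈ bidisk) :
    HasDerivAt (fun w => ev a (z, w)) (ev (derSnd a) (z, w)) w := by
  have := hasDerivAt_ev_fst ha.swap (swap_mem_bidisk hp)
  simpa only [ev_swap, derSnd_eq, Prod.swap_prod_mk] using this

theorem continuousOn_ev {a : ℕ × ℕ → ℂ} (ha : AbsConv a) : ContinuousOn (ev a) bidisk := by
  intro p hp
  obtain ⟨r, hr0, hr1, h1, h2⟩ := exists_radius hp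
  have hopen : IsOpen (ball (0 : ℂ) r ×ˢ ball (0 : ℂ) r) := isOpen_ball.prod isOpen_ball
  have : ContinuousOn (ev a) (ball (0 : ℂ) r ×ˢ ball (0 : ℂ) r) :=
    continuousOn_tsum (fun i => by fun_prop) (ha r hr0.le hr1) fun i q hq =>
      norm_monomial_le _ (mem_ball_zero_iff.1 hq.1).le (mem_ball_zero_iff.1 hq.2).le i
  exact (this.continuousAt (hopen.mem_nhds (by simp [h1, h2]))).continuousWithinAt

theorem hasFDerivAt_ev {a : ℕ × ℕ → ℂ} (ha : AbsConv a) {p : ℂ × ℂ} (hp : p ∈ bidisk) :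
    HasFDerivAt (ev a) ((ContinuousLinearMap.toSpanSingleton ℂ (ev (derFst a) p)).coprod
      (ContinuousLinearMap.toSpanSingleton ℂ (ev (derSnd a) p))) p := by
  have hev : ∀ᶠ q in nhds p, q ∈ bidisk := isOpen_bidisk.mem_nhds hp
  have hT : Continuous (ContinuousLinearMap.toSpanSingletonLE ℂ ℂ ℂ) :=
    LinearMap.continuous_of_finiteDimensional _
  exact (hasStrictFDerivAt_uncurry_coprod (𝕜 := ℂ) (u := p) (f := fun z w => ev a (z, w))
    (f₁ := fun z w => ContinuousLinearMap.toSpanSingleton ℂ (ev (derFst a) (z, w)))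
    (f₂ := fun z w => ContinuousLinearMap.toSpanSingleton ℂ (ev (derSnd a) (z, w)))
    (hev.mono fun q hq => (hasDerivAt_ev_fst ha hq).hasFDerivAt)
    (hev.mono fun q hq => (hasDerivAt_ev_snd ha hq).hasFDerivAt)
    (hT.continuousAt.comp ((continuousOn_ev ha.derFst).continuousAt hev))
    (hT.continuousAt.comp ((continuousOn_ev ha.derSnd).continuousAt hev))).hasFDerivAt

theorem differentiableOn_ev {a : ℕ × ℕ → ℂ} (ha : AbsConv a) :
    DifferentiableOn ℂ (ev a) bidisk := fun _ hp =>
  (hasFDerivAt_ev ha hp).differentiableAt.differentiableWithinAt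

/-- The coefficients of a double power series are determined by its sum on the bidisk. -/
theorem eq_zero_of_ev_eq_zero {a : ℕ × ℕ → ℂ} (ha : AbsConv a) (h : ∀ p ∈ bidisk, ev a p = 0) :
    a = 0 := by
  have hF : ∀ {a : ℕ × ℕ → ℂ}, AbsConv a → (∀ p ∈ bidisk, ev a p = 0) →
      ∀ p ∈ bidisk, ev (derFst a) p = 0 := by
    rintro a ha h ⟨z, w⟩ hp
    have hz : (fun z => ev a (z, w)) =ᶠ[nhds z] fun _ => 0 := by
      filter_upwards [isOpen_ball.mem_nhds hp.1] with z' hz' using h _ ⟨hz', hp.2⟩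
    rw [← (hasDerivAt_ev_fst ha hp).deriv, hz.deriv_eq, deriv_const]
  have hS : ∀ {a : ℕ × ℕ → ℂ}, AbsConv a → (∀ p ∈ bidisk, ev a p = 0) →
      ∀ p ∈ bidisk, ev (derSnd a) p = 0 := by
    intro a ha h p hp
    rw [derSnd_eq, ev_swap]
    exact hF ha.swap (fun q hq => by rw [ev_swap, h _ (swap_mem_bidisk hq)]) _ (swap_mem_bidisk hp)
  have h00 : ∀ {a : ℕ × ℕ → ℂ}, (∀ p ∈ bidisk, ev a p = 0) → a (0, 0) = 0 := by
    intro a h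
    rw [← h (0, 0) (by simp [mem_bidisk]), ev, tsum_eq_single (0, 0)]
    · simp
    · rintro ⟨j, k⟩ hjk
      cases j <;> cases k <;> simp_all
  have key : ∀ (k j : ℕ) {a : ℕ × ℕ → ℂ}, AbsConv a → (∀ p ∈ bidisk, ev a p = 0) →
      a (j, k) = 0 := by
    intro k
    induction k with
    | zero =>
      intro j
      induction j with
      | zero => exact fun _ h => h00 h
      | succ j ih =>
        intro a ha h
        have := ih ha.derFst (hF ha h)
        simpa [derFst, Nat.cast_add_one_ne_zero] using this
    | succ k ih =>
      intro j a ha h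
      have := ih j ha.derSnd (hS ha h)
      simpa [derSnd, Nat.cast_add_one_ne_zero] using this
  funext ⟨j, k⟩
  exact key k j ha h

theorem eq_of_ev_eq {a b : ℕ × ℕ → ℂ} (ha : AbsConv a) (hb : AbsConv b)
    (h : ∀ p ∈ bidisk, ev a p = ev b p) : a = b :=
  sub_eq_zero.1 <| eq_zero_of_ev_eq_zero (ha.sub hb) fun p hp => by
    rw [ev_sub ha hb hp, h p hp, sub_self]

theorem invLaplacian_ev {a : ℕ × ℕ → ℂ} (ha : AbsConv a) {p : ℂ × ℂ} (hp : p ∈ bidisk) :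
    invLaplacian (ev a) p = 4 * (1 - p.1 * p.2) ^ 2 * ev (derFst (derSnd a)) p := by
  obtain ⟨z, w⟩ := p
  have hev : (fun z' => deriv (fun w' => ev a (z', w')) w) =ᶠ[nhds z]
      fun z' => ev (derSnd a) (z', w) := by
    filter_upwards [isOpen_ball.mem_nhds hp.1] with z' hz'
    exact (hasDerivAt_ev_snd ha ⟨hz', hp.2⟩).deriv
  simp only [invLaplacian]
  rw [hev.deriv_eq, (hasDerivAt_ev_fst ha.derSnd hp).deriv]

/-! ### Taylor expansion of separately holomorphic functions -/

/-- The `n`-th Taylor coefficient at `0` of a function of one complex variable. -/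
def taylorCoeff (n : ℕ) (f : ℂ → ℂ) : ℂ := (n.factorial : ℂ)⁻¹ * iteratedDeriv n f 0

theorem hasSum_taylorCoeff {f : ℂ → ℂ} (hf : DifferentiableOn ℂ f (ball 0 1)) {z : ℂ}
    (hz : z ∈ ball (0 : ℂ) 1) : HasSum (fun n => taylorCoeff n f * z ^ n) (f z) := by
  refine (hasSum_taylorSeries_on_ball hf hz).congr_fun fun n => ?_
  simp only [taylorCoeff, sub_zero, smul_eq_mul]
  ring

theorem norm_taylorCoeff_le {f : ℂ → ℂ} (hf : DifferentiableOn ℂ f (ball 0 1)) {r M : ℝ}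
    (h0 : 0 < r) (h1 : r < 1) (hM : ∀ z ∈ closedBall (0 : ℂ) r, ‖f z‖ ≤ M) (n : ℕ) :
    ‖taylorCoeff n f‖ ≤ M / r ^ n := by
  have hd : DiffContOnCl ℂ f (ball 0 r) :=
    (hf.mono (by rw [closure_ball _ h0.ne']; exact closedBall_subset_ball h1)).diffContOnCl
  have := norm_iteratedDeriv_le_of_forall_mem_sphere_norm_le n h0 hd
    fun z hz => hM z (sphere_subset_closedBall hz)
  have hn : (0 : ℝ) < n.factorial := by positivity
  rw [taylorCoeff, norm_mul, norm_inv, Complex.norm_natCast, inv_mul_le_iff₀ hn]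
  rwa [mul_div_assoc] at this

/-- The Taylor coefficients in `z` of a continuous separately holomorphic function are
holomorphic in `w`, being locally uniform limits of difference quotients of higher order. -/
theorem differentiableOn_taylorCoeff {F : ℂ × ℂ → ℂ} (hF : ContinuousOn F bidisk)
    (h1 : ∀ w ∈ ball (0 : ℂ) 1, DifferentiableOn ℂ (fun z => F (z, w)) (ball 0 1))
    (h2 : ∀ z ∈ ball (0 : ℂ) 1, DifferentiableOn ℂ (fun w => F (z, w)) (ball 0 1)) (j : ℕ) :
    DifferentiableOn ℂ (fun w => taylorCoeff j fun z => F (z, w)) (ball 0 1) := by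
  induction j using Nat.strong_induction_on with
  | _ j ih =>
  set g : ℕ → ℂ → ℂ := fun j w => taylorCoeff j fun z => F (z, w) with hg
  intro w₀ hw₀
  obtain ⟨r, hr, hr1⟩ := exists_between (mem_ball_zero_iff.1 hw₀)
  have hr0 : 0 < r := (norm_nonneg _).trans_lt hr
  have hsub : closedBall (0 : ℂ) r ×ˢ closedBall (0 : ℂ) r ⊆ bidisk :=
    Set.prod_mono (closedBall_subset_ball hr1) (closedBall_subset_ball hr1)
  obtain ⟨M, hM⟩ := ((isCompact_closedBall (0 : ℂ) r).prod
    (isCompact_closedBall (0 : ℂ) r)).exists_bound_of_continuousOn (hF.mono hsub)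
  have hM0 : 0 ≤ M := (norm_nonneg _).trans (hM (0, 0) (by simp [hr0.le]))
  have hbr : ball (0 : ℂ) r ⊆ ball 0 1 := ball_subset_ball hr1.le
  have hgb : ∀ i, ∀ w ∈ ball (0 : ℂ) r, ‖g i w‖ ≤ M / r ^ i := fun i w hw =>
    norm_taylorCoeff_le (h1 w (hbr hw)) hr0 hr1
      (fun z hz => hM (z, w) ⟨hz, ball_subset_closedBall hw⟩) i
  let x : ℕ → ℝ := fun n => 1 / 2 / ((n : ℝ) + 1)
  have hx0 : ∀ n, 0 < x n := fun n => by positivity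
  have hx2 : ∀ n, x n ≤ 1 / 2 := fun n => div_le_self (by norm_num) (by simp)
  have hxlim : Filter.Tendsto x Filter.atTop (nhds 0) :=
    tendsto_const_nhds.div_atTop
      (Filter.tendsto_atTop_add_const_right _ _ tendsto_natCast_atTop_atTop)
  let ζ : ℕ → ℂ := fun n => ((r * x n : ℝ) : ℂ)
  have hζ : ∀ n, ‖ζ n‖ = r * x n := fun n => by
    rw [norm_real, Real.norm_of_nonneg (mul_nonneg hr0.le (hx0 n).le)]
  have hζ0 : ∀ n, ζ n ≠ 0 := fun n => norm_pos_iff.1 (by rw [hζ]; exact mul_pos hr0 (hx0 n))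
  have hζ1 : ∀ n, ζ n ∈ ball (0 : ℂ) 1 := fun n => by
    rw [mem_ball_zero_iff, hζ]
    nlinarith [hx2 n, hx0 n]
  -- The remainder after subtracting the first `j` Taylor terms, divided by `ζ ^ j`.
  let q : ℕ → ℂ → ℂ := fun n w =>
    (F (ζ n, w) - ∑ i ∈ Finset.range j, g i w * ζ n ^ i) * (ζ n ^ j)⁻¹
  have hqd : ∀ n, DifferentiableOn ℂ (q n) (ball 0 r) := fun n => by
    refine DifferentiableOn.mul_const (((h2 _ (hζ1 n)).mono hbr).sub ?_) _
    exact DifferentiableOn.fun_sum fun i hi =>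
      ((ih i (Finset.mem_range.1 hi)).mono hbr).mul_const _
  have hqb : ∀ n, ∀ w ∈ ball (0 : ℂ) r, dist (q n w) (g j w) ≤ 2 * (M / r ^ j) * x n := by
    intro n w hw
    have hs := (hasSum_nat_add_iff' (j + 1)).2 (hasSum_taylorCoeff (h1 w (hbr hw)) (hζ1 n))
    have hgeo := (hasSum_geometric_of_lt_one (hx0 n).le
      (by linarith [hx2 n] : x n < 1)).mul_left (M * x n ^ (j + 1))
    have hle := hs.norm_le_of_bounded hgeo fun i => by
      rw [norm_mul, norm_pow, hζ]
      calc _ ≤ M / r ^ (i + (j + 1)) * (r * x n) ^ (i + (j + 1)) := by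
            have := pow_nonneg (mul_nonneg hr0.le (hx0 n).le) (i + (j + 1))
            gcongr
            exact hgb _ w hw
        _ = _ := by
            rw [mul_pow]
            field_simp
            ring
    have heq : q n w - g j w =
        (F (ζ n, w) - ∑ i ∈ Finset.range (j + 1), g i w * ζ n ^ i) * (ζ n ^ j)⁻¹ := by
      have := pow_ne_zero j (hζ0 n)
      simp only [q, Finset.sum_range_succ]
      field_simp
      ring
    have hinv : (1 - x n)⁻¹ ≤ 2 := by
      rw [inv_le_comm₀ (by linarith [hx2 n]) (by norm_num)]
      linarith [hx2 n]
    rw [dist_eq_norm, heq, norm_mul, norm_inv, norm_pow, hζ]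
    calc _ ≤ M * x n ^ (j + 1) * 2 * ((r * x n) ^ j)⁻¹ := by
          have : 0 ≤ ((r * x n) ^ j)⁻¹ := inv_nonneg.2 (pow_nonneg (mul_nonneg hr0.le (hx0 n).le) _)
          have h3 : 0 ≤ M * x n ^ (j + 1) := mul_nonneg hM0 (pow_nonneg (hx0 n).le _)
          gcongr
          exact hle.trans (by gcongr)
      _ = _ := by
          have := (hx0 n).ne'
          rw [mul_pow]
          field_simp
          ring
  have hlim : TendstoLocallyUniformlyOn q (g j) Filter.atTop (ball 0 r) := by
    apply TendstoUniformlyOn.tendstoLocallyUniformlyOn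
    rw [Metric.tendstoUniformlyOn_iff]
    intro ε hε
    have ht : Filter.Tendsto (fun n => 2 * (M / r ^ j) * x n) Filter.atTop (nhds 0) := by
      simpa using hxlim.const_mul (2 * (M / r ^ j))
    filter_upwards [ht.eventually (gt_mem_nhds hε)] with n hn w hw
    rw [dist_comm]
    exact (hqb n w hw).trans_lt hn
  exact ((hlim.differentiableOn (Filter.Eventually.of_forall hqd) isOpen_ball).differentiableAt
    (isOpen_ball.mem_nhds (mem_ball_zero_iff.2 hr))).differentiableWithinAt

/-- A continuous separately holomorphic function on the bidisk is the sum of an absolutely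
convergent double power series. -/
theorem exists_ev_eq {F : ℂ × ℂ → ℂ} (hF : ContinuousOn F bidisk)
    (h1 : ∀ w ∈ ball (0 : ℂ) 1, DifferentiableOn ℂ (fun z => F (z, w)) (ball 0 1))
    (h2 : ∀ z ∈ ball (0 : ℂ) 1, DifferentiableOn ℂ (fun w => F (z, w)) (ball 0 1)) :
    ∃ a, AbsConv a ∧ (∀ p ∈ bidisk, F p = ev a p) ∧
      ∀ r M : ℝ, 0 < r → r < 1 →
        (∀ p ∈ closedBall (0 : ℂ) r ×ˢ closedBall (0 : ℂ) r, ‖F p‖ ≤ M) →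
        ∀ i, ‖a i‖ ≤ M / r ^ (i.1 + i.2) := by
  set g : ℕ → ℂ → ℂ := fun j w => taylorCoeff j fun z => F (z, w) with hg
  have hgd : ∀ j, DifferentiableOn ℂ (g j) (ball 0 1) := differentiableOn_taylorCoeff hF h1 h2
  let a : ℕ × ℕ → ℂ := fun i => taylorCoeff i.2 (g i.1)
  have hbound : ∀ r M : ℝ, 0 < r → r < 1 →
      (∀ p ∈ closedBall (0 : ℂ) r ×ˢ closedBall (0 : ℂ) r, ‖F p‖ ≤ M) →
      ∀ i, ‖a i‖ ≤ M / r ^ (i.1 + i.2) := by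
    intro r M h0 hr1 hM i
    have := norm_taylorCoeff_le (hgd i.1) h0 hr1 (fun w hw =>
      norm_taylorCoeff_le (h1 w (closedBall_subset_ball hr1 hw)) h0 hr1
        (fun z hz => hM (z, w) ⟨hz, hw⟩) i.1) i.2
    rwa [div_div, ← pow_add] at this
  have ha : AbsConv a := by
    intro r h0 hr1
    obtain ⟨s, hs, hs1⟩ := exists_between hr1
    have hs0 : 0 < s := h0.trans_lt hs
    have hsub : closedBall (0 : ℂ) s ×ˢ closedBall (0 : ℂ) s ⊆ bidisk :=
      Set.prod_mono (closedBall_subset_ball hs1) (closedBall_subset_ball hs1)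
    obtain ⟨M, hM⟩ := ((isCompact_closedBall (0 : ℂ) s).prod
      (isCompact_closedBall (0 : ℂ) s)).exists_bound_of_continuousOn (hF.mono hsub)
    have hq : r / s < 1 := (div_lt_one hs0).2 hs
    have hgeo := summable_geometric_of_lt_one (div_nonneg h0 hs0.le) hq
    refine ((hgeo.mul_of_nonneg hgeo (fun _ => by positivity) fun _ => by positivity).mul_left
      M).of_nonneg_of_le (fun i => by positivity) fun i => ?_
    calc ‖a i‖ * r ^ (i.1 + i.2) ≤ M / s ^ (i.1 + i.2) * r ^ (i.1 + i.2) := by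
          gcongr
          exact hbound s M hs0 hs1 hM i
      _ = _ := by
          rw [← pow_add, div_pow]
          ring
  refine ⟨a, ha, ?_, hbound⟩
  rintro ⟨z, w⟩ ⟨hz, hw⟩
  have hsum := ha.summable (p := (z, w)) ⟨hz, hw⟩
  rw [ev, hsum.tsum_prod, ← (hasSum_taylorCoeff (h1 w hw) hz).tsum_eq]
  refine tsum_congr fun j => ?_
  change g j w * z ^ j = _
  rw [← (hasSum_taylorCoeff (hgd j) hw).tsum_eq, ← tsum_mul_right]
  refine tsum_congr fun k => ?_
  simp only [a]
  ring

/-- Cauchy's estimate for double power series. -/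
theorem norm_coeff_le {a : ℕ × ℕ → ℂ} (ha : AbsConv a) {r M : ℝ} (h0 : 0 < r) (h1 : r < 1)
    (hM : ∀ p ∈ closedBall (0 : ℂ) r ×ˢ closedBall (0 : ℂ) r, ‖ev a p‖ ≤ M) (i : ℕ × ℕ) :
    ‖a i‖ ≤ M / r ^ (i.1 + i.2) := by
  have hd := differentiableOn_ev ha
  obtain ⟨b, hb, hb', hb''⟩ := exists_ev_eq hd.continuousOn
    (fun w hw z hz => (differentiableAt_slice_fst hd ⟨hz, hw⟩).differentiableWithinAt)
    (fun z hz w hw => (differentiableAt_slice_snd hd ⟨hz, hw⟩).differentiableWithinAt)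
  rw [eq_of_ev_eq ha hb hb']
  exact hb'' r M h0 h1 hM i

/-! ### Coefficients of eigenfunctions -/

theorem exists_radius_of_isCompact {K : Set bidisk} (hK : IsCompact K) :
    ∃ r : ℝ, 0 < r ∧ r < 1 ∧ ∀ p ∈ K, ‖p.1.1‖ ≤ r ∧ ‖p.1.2‖ ≤ r := by
  rcases K.eq_empty_or_nonempty with rfl | hne
  · exact ⟨1 / 2, by norm_num, by norm_num, by simp⟩
  obtain ⟨p, -, hp⟩ := hK.exists_isMaxOn hne
    (f := fun p : bidisk => max ‖p.1.1‖ ‖p.1.2‖) (by fun_prop)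
  obtain ⟨r, hr0, hr1, h1, h2⟩ := exists_radius p.2
  refine ⟨r, hr0, hr1, fun q hq => ?_⟩
  have := (isMaxOn_iff.1 hp q hq).trans (max_lt h1 h2).le
  exact ⟨(le_max_left _ _).trans this, (le_max_right _ _).trans this⟩

/-- Convergence in `C(𝔻², ℂ)` follows from uniform estimates on the closed polydisks. -/
theorem tendsto_of_dist_le {ι : Type*} {l : Filter ι} {G : ι → C(bidisk, ℂ)} {F : C(bidisk, ℂ)}
    (h : ∀ r : ℝ, 0 < r → r < 1 → ∃ u : ι → ℝ, Filter.Tendsto u l (nhds 0) ∧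
      ∀ᶠ n in l, ∀ p : bidisk, ‖p.1.1‖ ≤ r → ‖p.1.2‖ ≤ r → dist (G n p) (F p) ≤ u n) :
    Filter.Tendsto G l (nhds F) := by
  rw [ContinuousMap.tendsto_iff_forall_isCompact_tendstoUniformlyOn]
  intro K hK
  obtain ⟨r, hr0, hr1, hr⟩ := exists_radius_of_isCompact hK
  obtain ⟨u, hu, hle⟩ := h r hr0 hr1
  rw [Metric.tendstoUniformlyOn_iff]
  intro ε hε
  filter_upwards [hle, hu.eventually (gt_mem_nhds hε)] with n h1 h2 p hp
  rw [dist_comm]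
  exact (h1 p (hr p hp).1 (hr p hp).2).trans_lt h2

/-- Functions close to `F` in `C(𝔻², ℂ)` are uniformly close to `F` on closed polydisks. -/
theorem eventually_nhds_dist_lt (F : C(bidisk, ℂ)) {r ε : ℝ} (hr : r < 1) (hε : 0 < ε) :
    ∀ᶠ G in nhds F, ∀ p : bidisk, ‖p.1.1‖ ≤ r → ‖p.1.2‖ ≤ r → dist (F p) (G p) < ε := by
  have hK : IsCompact ((↑) ⁻¹' (closedBall (0 : ℂ) r ×ˢ closedBall (0 : ℂ) r) : Set bidisk) := by
    refine Topology.IsInducing.subtypeVal.isCompact_preimage' ((isCompact_closedBall _ _).prod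
      (isCompact_closedBall _ _)) ?_
    rw [Subtype.range_coe]
    exact Set.prod_mono (closedBall_subset_ball hr) (closedBall_subset_ball hr)
  have := ContinuousMap.tendsto_iff_forall_isCompact_tendstoUniformlyOn.1
    (Filter.tendsto_id (x := nhds F)) _ hK
  filter_upwards [Metric.tendstoUniformlyOn_iff.1 this ε hε] with G hG p h1 h2
  exact hG p (by simp [h1, h2])

/-- `F` is the sum of the absolutely convergent double power series with coefficients `a`. -/
def HasCoeffs (F : C(bidisk, ℂ)) (a : ℕ × ℕ → ℂ) : Prop :=
  AbsConv a ∧ ∀ p : bidisk, F p = ev a p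

/-- The sum of an absolutely convergent double power series as a continuous function. -/
def evMap (a : ℕ × ℕ → ℂ) (ha : AbsConv a) : C(bidisk, ℂ) :=
  ⟨fun p => ev a p, (continuousOn_ev ha).domRestrict⟩

theorem hasCoeffs_evMap {a : ℕ × ℕ → ℂ} (ha : AbsConv a) : HasCoeffs (evMap a ha) a :=
  ⟨ha, fun _ => rfl⟩

namespace HasCoeffs

variable {F G : C(bidisk, ℂ)} {a b : ℕ × ℕ → ℂ}

theorem unique (h : HasCoeffs F a) (h' : HasCoeffs F b) : a = b :=
  eq_of_ev_eq h.1 h'.1 fun p hp => (h.2 ⟨p, hp⟩).symm.trans (h'.2 ⟨p, hp⟩)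

theorem ext (h : HasCoeffs F a) (h' : HasCoeffs G a) : F = G :=
  ContinuousMap.ext fun p => (h.2 p).trans (h'.2 p).symm

theorem add (h : HasCoeffs F a) (h' : HasCoeffs G b) : HasCoeffs (F + G) (a + b) :=
  ⟨h.1.add h'.1, fun p => by rw [ev_add h.1 h'.1 p.2, ← h.2, ← h'.2]; rfl⟩

theorem smul (c : ℂ) (h : HasCoeffs F a) : HasCoeffs (c • F) (c • a) :=
  ⟨h.1.smul c, fun p => by rw [ev_smul, ← h.2]; rfl⟩

theorem sub (h : HasCoeffs F a) (h' : HasCoeffs G b) : HasCoeffs (F - G) (a - b) :=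
  ⟨h.1.sub h'.1, fun p => by rw [ev_sub h.1 h'.1 p.2, ← h.2, ← h'.2]; rfl⟩

theorem zero : HasCoeffs 0 0 := ⟨absConv_zero, fun p => (ev_zero p).symm⟩

theorem sum {ι : Type*} (s : Finset ι) {F : ι → C(bidisk, ℂ)} {a : ι → ℕ × ℕ → ℂ}
    (h : ∀ i ∈ s, HasCoeffs (F i) (a i)) : HasCoeffs (∑ i ∈ s, F i) (∑ i ∈ s, a i) := by
  classical
  induction s using Finset.induction_on with
  | empty => simpa using zero
  | insert i s hi ih =>
    rw [Finset.sum_insert hi, Finset.sum_insert hi]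
    exact (h i (Finset.mem_insert_self i s)).add
      (ih fun j hj => h j (Finset.mem_insert_of_mem hj))

theorem swap (h : HasCoeffs F a) : HasCoeffs (F.comp bidiskSwap) (a ∘ Prod.swap) :=
  ⟨h.1.swap, fun p => by rw [ev_swap]; exact h.2 _⟩

theorem extZero_eq (h : HasCoeffs F a) {p : ℂ × ℂ} (hp : p ∈ bidisk) :
    extZero F p = ev a p := (extZero_apply F ⟨p, hp⟩).trans (h.2 _)

end HasCoeffs

theorem continuousOn_extZero (F : C(bidisk, ℂ)) : ContinuousOn (extZero F) bidisk := by
  rw [continuousOn_iff_continuous_domRestrict]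
  exact F.continuous.congr fun p => (extZero_apply F p).symm

theorem exists_hasCoeffs {F : C(bidisk, ℂ)} (hF : IsHolomorphic F) : ∃ a, HasCoeffs F a := by
  obtain ⟨a, ha, hFa, -⟩ := exists_ev_eq (continuousOn_extZero F)
    (fun w hw z hz => (differentiableAt_slice_fst hF ⟨hz, hw⟩).differentiableWithinAt)
    (fun z hz w hw => (differentiableAt_slice_snd hF ⟨hz, hw⟩).differentiableWithinAt)
  exact ⟨a, ha, fun p => (extZero_apply F p).symm.trans (hFa p p.2)⟩

/-- The equation `4 (1 - zw)² ∂_z ∂_w F = λ F` in terms of the coefficients of `F`. -/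
def EigenCoeffs (lam : ℂ) (a : ℕ × ℕ → ℂ) : Prop :=
  (4 : ℂ) • (derFst (derSnd a) - (2 : ℂ) • mulFst (mulSnd (derFst (derSnd a))) +
    mulFst (mulSnd (mulFst (mulSnd (derFst (derSnd a)))))) = lam • a

theorem invLaplacian_congr {F G : ℂ × ℂ → ℂ} (h : ∀ p ∈ bidisk, F p = G p) {p : ℂ × ℂ}
    (hp : p ∈ bidisk) : invLaplacian F p = invLaplacian G p := by
  obtain ⟨z, w⟩ := p
  have hev : (fun z' => deriv (fun w' => F (z', w')) w) =ᶠ[nhds z]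
      fun z' => deriv (fun w' => G (z', w')) w := by
    filter_upwards [isOpen_ball.mem_nhds hp.1] with z' hz'
    refine Filter.EventuallyEq.deriv_eq ?_
    filter_upwards [isOpen_ball.mem_nhds hp.2] with w' hw' using h _ ⟨hz', hw'⟩
  simp only [invLaplacian]
  rw [hev.deriv_eq]

theorem HasCoeffs.mem_eigenspace_iff {F : C(bidisk, ℂ)} {a : ℕ × ℕ → ℂ} (h : HasCoeffs F a)
    {lam : ℂ} : F ∈ eigenspace lam ↔ EigenCoeffs lam a := by
  have hb := h.1.derSnd.derFst
  set b := derFst (derSnd a) with hb_def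
  have hl : ∀ p ∈ bidisk, ev ((4 : ℂ) • (b - (2 : ℂ) • mulFst (mulSnd b) +
      mulFst (mulSnd (mulFst (mulSnd b))))) p = invLaplacian (extZero F) p := by
    intro p hp
    rw [invLaplacian_congr (fun q hq => h.extZero_eq hq) hp, invLaplacian_ev h.1 hp, ev_smul,
      ev_add (hb.sub (hb.mulSnd.mulFst.smul 2)) hb.mulSnd.mulFst.mulSnd.mulFst hp,
      ev_sub hb (hb.mulSnd.mulFst.smul 2) hp, ev_smul,
      ev_mulFst hb.mulSnd.mulFst.mulSnd hp, ev_mulSnd hb.mulSnd.mulFst hp,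
      ev_mulFst hb.mulSnd hp, ev_mulSnd hb hp, ← hb_def]
    ring
  have hconv : AbsConv ((4 : ℂ) • (b - (2 : ℂ) • mulFst (mulSnd b) +
      mulFst (mulSnd (mulFst (mulSnd b))))) :=
    ((hb.sub (hb.mulSnd.mulFst.smul 2)).add hb.mulSnd.mulFst.mulSnd.mulFst).smul 4
  constructor
  · rintro ⟨-, hF⟩
    refine eq_of_ev_eq hconv (h.1.smul lam) fun p hp => ?_
    rw [hl p hp, ev_smul, ← h.2 ⟨p, hp⟩]
    exact hF ⟨p, hp⟩
  · intro hE
    refine ⟨(differentiableOn_ev h.1).congr fun p hp => h.extZero_eq hp, fun p => ?_⟩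
    rw [← hl p p.2, show _ = lam • a from hE, ev_smul, ← h.2]

theorem exists_of_mem_eigenspace {lam : ℂ} {F : C(bidisk, ℂ)} (hF : F ∈ eigenspace lam) :
    ∃ a, HasCoeffs F a ∧ EigenCoeffs lam a := by
  obtain ⟨a, ha⟩ := exists_hasCoeffs hF.1
  exact ⟨a, ha, ha.mem_eigenspace_iff.1 hF⟩

theorem continuous_mulFst : Continuous mulFst := by
  refine continuous_pi ?_
  rintro ⟨j, k⟩
  cases j with
  | zero => exact continuous_const
  | succ j => exact continuous_apply _

theorem continuous_mulSnd : Continuous mulSnd := by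
  refine continuous_pi ?_
  rintro ⟨j, k⟩
  cases k with
  | zero => exact continuous_const
  | succ k => exact continuous_apply _

theorem isClosed_eigenCoeffs (lam : ℂ) : IsClosed {a | EigenCoeffs lam a} := by
  have h1 : Continuous derFst := by unfold derFst; fun_prop
  have h2 : Continuous derSnd := by unfold derSnd; fun_prop
  have h3 := continuous_mulFst
  have h4 := continuous_mulSnd
  exact isClosed_eq (by fun_prop) (by fun_prop)

theorem isClosed_eigenspace (lam : ℂ) : IsClosed (eigenspace lam : Set C(bidisk, ℂ)) := by
  rw [← closure_subset_iff_isClosed]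
  intro F hF
  set l : Filter C(bidisk, ℂ) := nhds F ⊓ Filter.principal (eigenspace lam) with hl
  have : l.NeBot := mem_closure_iff_clusterPt.1 hF
  have hmem : ∀ᶠ G in l, G ∈ eigenspace lam := Filter.mem_inf_of_right (Filter.mem_principal_self _)
  have hdist : ∀ {r ε : ℝ}, r < 1 → 0 < ε → ∀ᶠ G : C(bidisk, ℂ) in l,
      ∀ p : bidisk, ‖p.1.1‖ ≤ r → ‖p.1.2‖ ≤ r → dist (F p) (G p) < ε := fun hr hε =>
    (eventually_nhds_dist_lt F hr hε).filter_mono inf_le_left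
  -- On the slices of the bidisk, `F` is a locally uniform limit of holomorphic functions.
  have hslice : ∀ c : ℂ → ℂ × ℂ, Continuous c → (∀ z ∈ ball (0 : ℂ) 1, c z ∈ bidisk) →
      (∀ G ∈ eigenspace lam, DifferentiableOn ℂ (fun z => extZero G (c z)) (ball 0 1)) →
      DifferentiableOn ℂ (fun z => extZero F (c z)) (ball 0 1) := by
    intro c hc hcm hd
    have hlim : TendstoLocallyUniformlyOn (fun (G : C(bidisk, ℂ)) z => extZero G (c z))
        (fun z => extZero F (c z)) l (ball 0 1) := by
      rw [tendstoLocallyUniformlyOn_iff_forall_isCompact isOpen_ball]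
      intro K hK hKc
      have hKi : IsCompact ((↑) ⁻¹' (c '' K) : Set bidisk) :=
        Topology.IsInducing.subtypeVal.isCompact_preimage' (hKc.image hc) (by
          rw [Subtype.range_coe]
          rintro _ ⟨z, hz, rfl⟩
          exact hcm z (hK hz))
      obtain ⟨r, -, hr1, hr⟩ := exists_radius_of_isCompact hKi
      rw [Metric.tendstoUniformlyOn_iff]
      intro ε hε
      filter_upwards [hdist hr1 hε] with G hG z hz
      have hz' := hr ⟨c z, hcm z (hK hz)⟩ ⟨z, hz, rfl⟩
      have := hG ⟨c z, hcm z (hK hz)⟩ hz'.1 hz'.2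
      rwa [← extZero_apply F, ← extZero_apply G] at this
    exact hlim.differentiableOn (hmem.mono hd) isOpen_ball
  obtain ⟨a, ha, hFa, -⟩ := exists_ev_eq (continuousOn_extZero F)
    (fun w hw => hslice (fun z => (z, w)) (by fun_prop) (fun z hz => ⟨hz, hw⟩) fun G hG z hz =>
      (differentiableAt_slice_fst hG.1 ⟨hz, hw⟩).differentiableWithinAt)
    (fun z hz => hslice (fun w => (z, w)) (by fun_prop) (fun w hw => ⟨hz, hw⟩) fun G hG w hw =>
      (differentiableAt_slice_snd hG.1 ⟨hz, hw⟩).differentiableWithinAt)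
  have hF' : HasCoeffs F a := ⟨ha, fun p => (extZero_apply F p).symm.trans (hFa p p.2)⟩
  refine hF'.mem_eigenspace_iff.2 ?_
  -- The coefficients depend continuously on the function by Cauchy's estimate.
  choose! c hc hcE using fun G => exists_of_mem_eigenspace (lam := lam) (F := G)
  have hlim : Filter.Tendsto c l (nhds a) := by
    rw [tendsto_pi_nhds]
    intro i
    rw [Metric.tendsto_nhds]
    intro ε hε
    have hδ : 0 < ε / 2 * (1 / 2) ^ (i.1 + i.2) := by positivity
    filter_upwards [hmem, hdist (by norm_num : (1 / 2 : ℝ) < 1) hδ] with G hG hGd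
    have hsub := hF'.sub (hc G hG)
    have hle := norm_coeff_le hsub.1 (r := 1 / 2) (by norm_num) (by norm_num)
      (M := ε / 2 * (1 / 2) ^ (i.1 + i.2)) (fun p hp => by
        have hp1 := mem_closedBall_zero_iff.1 hp.1
        have hp2 := mem_closedBall_zero_iff.1 hp.2
        have hpb : p ∈ bidisk := mem_bidisk.2 ⟨by linarith, by linarith⟩
        have := hGd ⟨p, hpb⟩ hp1 hp2
        rw [← hsub.2 ⟨p, hpb⟩]
        simpa [dist_eq_norm] using this.le) i
    rw [mul_div_assoc, div_self (by positivity), mul_one] at hle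
    rw [dist_comm, dist_eq_norm]
    exact hle.trans_lt (by linarith)
  exact (isClosed_eigenCoeffs lam).mem_of_tendsto hlim (hmem.mono hcE)

/-! ### Homogeneous components -/

/-- The boundary coefficient of degree `n`: the coefficient of `z ^ n` if `0 ≤ n`, and that of
`w ^ (-n)` if `n ≤ 0`. -/
def bd (a : ℕ × ℕ → ℂ) (n : ℤ) : ℂ := a (n.toNat, (-n).toNat)

/-- Multiplication of the coefficients by a factor depending on the degree `j - k` only. -/
def twist (χ : ℤ → ℂ) (a : ℕ × ℕ → ℂ) : ℕ × ℕ → ℂ := fun i => χ ((i.1 : ℤ) - i.2) * a i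

/-- The indicator function of a single degree. -/
def deltaAt (n k : ℤ) : ℂ := if k = n then 1 else 0

theorem bd_twist (χ : ℤ → ℂ) (a : ℕ × ℕ → ℂ) (n : ℤ) : bd (twist χ a) n = χ n * bd a n := by
  simp [bd, twist]

theorem bd_swap (a : ℕ × ℕ → ℂ) (n : ℤ) : bd (a ∘ Prod.swap) n = bd a (-n) := by
  simp [bd]

theorem bd_natCast (a : ℕ × ℕ → ℂ) (n : ℕ) : bd a n = a (n, 0) := by simp [bd]

theorem bd_neg_natCast (a : ℕ × ℕ → ℂ) (n : ℕ) : bd a (-n) = a (0, n) := by simp [bd]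

theorem AbsConv.twist {a : ℕ × ℕ → ℂ} (ha : AbsConv a) {χ : ℤ → ℂ} (hχ : ∀ n, ‖χ n‖ ≤ 1) :
    AbsConv (twist χ a) := ha.mono fun i => by
  rw [_root_.twist, norm_mul]
  exact mul_le_of_le_one_left (norm_nonneg _) (hχ _)

theorem norm_deltaAt_le (n k : ℤ) : ‖deltaAt n k‖ ≤ 1 := by
  unfold deltaAt
  split_ifs <;> simp

theorem derFst_derSnd_twist (χ : ℤ → ℂ) (a : ℕ × ℕ → ℂ) :
    derFst (derSnd (twist χ a)) = twist χ (derFst (derSnd a)) := by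
  funext ⟨j, k⟩
  simp only [derFst, derSnd, twist]
  push_cast
  rw [add_sub_add_right_eq_sub]
  ring

theorem mulFst_mulSnd_twist (χ : ℤ → ℂ) (a : ℕ × ℕ → ℂ) :
    mulFst (mulSnd (twist χ a)) = twist χ (mulFst (mulSnd a)) := by
  funext ⟨j, k⟩
  rcases j with _ | j <;> rcases k with _ | k <;> simp [mulFst, mulSnd, twist]

/-- The equation for the coefficients relates only coefficients of the same degree. -/
theorem EigenCoeffs.twist {lam : ℂ} {a : ℕ × ℕ → ℂ} (h : EigenCoeffs lam a) (χ : ℤ → ℂ) :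
    EigenCoeffs lam (twist χ a) := by
  funext i
  have hi := congrFun h i
  simp only [derFst_derSnd_twist, mulFst_mulSnd_twist]
  simp only [Pi.add_apply, Pi.sub_apply, Pi.smul_apply, smul_eq_mul, _root_.twist] at hi ⊢
  linear_combination χ ((i.1 : ℤ) - i.2) * hi

theorem EigenCoeffs.swap {lam : ℂ} {a : ℕ × ℕ → ℂ} (h : EigenCoeffs lam a) :
    EigenCoeffs lam (a ∘ Prod.swap) := by
  have h1 : ∀ b, mulFst (mulSnd (b ∘ Prod.swap)) = mulFst (mulSnd b) ∘ Prod.swap := by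
    intro b
    funext ⟨j, k⟩
    rcases j with _ | j <;> rcases k with _ | k <;> simp [mulFst, mulSnd]
  have h2 : derFst (derSnd (a ∘ Prod.swap)) = derFst (derSnd a) ∘ Prod.swap := by
    funext ⟨j, k⟩
    simp only [derFst, derSnd, Function.comp_apply, Prod.swap_prod_mk]
    ring
  funext i
  have hi := congrFun h i.swap
  simp only [h2, h1]
  exact hi

theorem EigenCoeffs.apply_one_snd {lam : ℂ} {a : ℕ × ℕ → ℂ} (h : EigenCoeffs lam a) (j : ℕ) :
    4 * ((j + 1) * a (j + 1, 1)) = lam * a (j, 0) := by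
  have := congrFun h (j, 0)
  rcases j with _ | j <;> simpa [mulFst, mulSnd, derFst, derSnd] using this

/-- The boundary coefficients determine the solution of the equation. -/
theorem EigenCoeffs.eq_zero {lam : ℂ} {a : ℕ × ℕ → ℂ} (h : EigenCoeffs lam a)
    (h0 : ∀ n, bd a n = 0) : a = 0 := by
  have key : ∀ j k, a (j, k) = 0 := by
    intro j
    induction j using Nat.strong_induction_on with
    | _ j ih =>
    intro k
    rcases j with _ | j
    · simpa only [bd_neg_natCast] using h0 (-(k : ℤ))
    rcases k with _ | k
    · simpa only [bd_natCast] using h0 ((j + 1 : ℕ) : ℤ)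
    have hjk := congrFun h (j, k)
    have hj : ∀ k, a (j, k) = 0 := ih j (by omega)
    have h1 : (2 : ℂ) * mulFst (mulSnd (derFst (derSnd a))) (j, k) = 0 := by
      rcases j with _ | j <;> rcases k with _ | k <;> simp [mulFst, mulSnd, derFst, derSnd, hj]
    have h2 : mulFst (mulSnd (mulFst (mulSnd (derFst (derSnd a))))) (j, k) = 0 := by
      rcases j with _ | _ | j <;> rcases k with _ | _ | k <;>
        simp [mulFst, mulSnd, derFst, derSnd, ih]
    simp only [Pi.add_apply, Pi.sub_apply, Pi.smul_apply, smul_eq_mul, h1, h2, hj] at hjk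
    have hj' : (j : ℂ) + 1 ≠ 0 := Nat.cast_add_one_ne_zero j
    have hk' : (k : ℂ) + 1 ≠ 0 := Nat.cast_add_one_ne_zero k
    simpa [derFst, derSnd, hj', hk'] using hjk
  funext ⟨j, k⟩
  exact key j k

theorem eq_of_bd_eq {lam : ℂ} {F G : C(bidisk, ℂ)} {a b : ℕ × ℕ → ℂ} (hF : HasCoeffs F a)
    (hG : HasCoeffs G b) (ha : EigenCoeffs lam a) (hb : EigenCoeffs lam b)
    (h : ∀ n, bd a n = bd b n) : F = G := by
  have hE : EigenCoeffs lam (a - b) := (hF.sub hG).mem_eigenspace_iff.1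
    (Submodule.sub_mem _ (hF.mem_eigenspace_iff.2 ha) (hG.mem_eigenspace_iff.2 hb))
  have := hE.eq_zero fun n => by simpa [bd, sub_eq_zero] using h n
  exact hF.ext (sub_eq_zero.1 this ▸ hG)

/-- Dominated convergence for power series twisted by factors depending on the degree. -/
theorem tendsto_of_twist {a : ℕ × ℕ → ℂ} (ha : AbsConv a) {χ : ℕ → ℤ → ℂ} {χ' : ℤ → ℂ}
    (hb : ∀ N k, ‖χ N k‖ ≤ 1)
    (hlim : ∀ k, Filter.Tendsto (fun N => χ N k) Filter.atTop (nhds (χ' k)))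
    {G : ℕ → C(bidisk, ℂ)} {F : C(bidisk, ℂ)} (hG : ∀ N, HasCoeffs (G N) (twist (χ N) a))
    (hF : HasCoeffs F (twist χ' a)) : Filter.Tendsto G Filter.atTop (nhds F) := by
  have hb' : ∀ k, ‖χ' k‖ ≤ 1 := fun k =>
    le_of_tendsto (hlim k).norm (Filter.Eventually.of_forall fun N => hb N k)
  refine tendsto_of_dist_le fun r h0 h1 => ?_
  have hterm : ∀ N (i : ℕ × ℕ), ‖twist (χ N) a i - twist χ' a i‖ * r ^ (i.1 + i.2) ≤
      2 * (‖a i‖ * r ^ (i.1 + i.2)) := by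
    intro N i
    rw [← mul_assoc, twist, twist, ← sub_mul, norm_mul]
    gcongr
    exact (norm_sub_le _ _).trans (by linarith [hb N (i.1 - i.2), hb' (i.1 - i.2)])
  refine ⟨fun N => ∑' i : ℕ × ℕ, ‖twist (χ N) a i - twist χ' a i‖ * r ^ (i.1 + i.2), ?_, ?_⟩
  · rw [show (0 : ℝ) = ∑' _ : ℕ × ℕ, (0 : ℝ) by simp]
    refine tendsto_tsum_of_dominated_convergence ((ha r h0.le h1).mul_left 2) (fun i => ?_)
      (Filter.Eventually.of_forall fun N i => ?_)
    · have : Filter.Tendsto (fun N => twist (χ N) a i - twist χ' a i) Filter.atTop (nhds 0) := by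
        have := ((hlim ((i.1 : ℤ) - i.2)).mul_const (a i)).sub_const (twist χ' a i)
        simpa [twist] using this
      simpa using this.norm.mul_const (r ^ (i.1 + i.2))
    · rw [Real.norm_of_nonneg (by positivity)]
      exact hterm N i
  · refine Filter.Eventually.of_forall fun N p hp1 hp2 => ?_
    have hs := (hG N).sub hF
    rw [dist_eq_norm, show G N p - F p = (G N - F) p from rfl, hs.2]
    refine tsum_of_norm_bounded (hs.1 r h0.le h1).hasSum fun i => ?_
    exact norm_monomial_le _ hp1 hp2 i

/-- The rotation `(z, w) ↦ (ω z, ω⁻¹ w)`. -/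
def rot (ω : ℂ) (hω : ‖ω‖ = 1) : C(bidisk, bidisk) where
  toFun p := ⟨(ω * p.1.1, ω⁻¹ * p.1.2), by
    have := p.2
    rw [← Prod.mk.eta (p := p.1), mem_bidisk] at this
    simpa [mem_bidisk, hω] using this⟩
  continuous_toFun := by fun_prop

theorem HasCoeffs.rot {F : C(bidisk, ℂ)} {a : ℕ × ℕ → ℂ} (h : HasCoeffs F a) {ω : ℂ}
    (hω : ‖ω‖ = 1) : HasCoeffs (F.comp (rot ω hω)) (twist (fun n => ω ^ n) a) := by
  have h0 : ω ≠ 0 := norm_pos_iff.1 (by rw [hω]; exact one_pos)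
  refine ⟨h.1.twist fun n => by simp [hω], fun p => (h.2 _).trans (tsum_congr fun i => ?_)⟩
  simp only [_root_.rot, twist, ContinuousMap.coe_mk, mul_pow, inv_pow, zpow_sub₀ h0, zpow_natCast]
  ring

theorem norm_exp_two_pi_div (N : ℕ) : ‖exp (2 * Real.pi * I / N)‖ = 1 := by
  rw [norm_exp]
  simp

/-- A closed rotation invariant subspace contains the homogeneous components of its elements: they
are limits of averages over the `N`-th roots of unity. -/
theorem component_mem {Y : Submodule ℂ C(bidisk, ℂ)} (hYc : IsClosed (Y : Set C(bidisk, ℂ)))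
    (hrot : ∀ (ω : ℂ) (hω : ‖ω‖ = 1), ∀ F ∈ Y, F.comp (rot ω hω) ∈ Y) {F : C(bidisk, ℂ)}
    (hF : F ∈ Y) {a : ℕ × ℕ → ℂ} (ha : HasCoeffs F a) (n : ℤ) :
    evMap (twist (deltaAt n) a) (ha.1.twist (norm_deltaAt_le n)) ∈ Y := by
  let ω : ℕ → ℂ := fun N => exp (2 * Real.pi * I / (N + 1 : ℕ))
  have hω : ∀ N, ‖ω N‖ = 1 := fun N => norm_exp_two_pi_div (N + 1)
  have hprim : ∀ N, IsPrimitiveRoot (ω N) (N + 1) := fun N =>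
    isPrimitiveRoot_exp (N + 1) N.succ_ne_zero
  have hωl : ∀ N (l : ℕ), ‖ω N ^ l‖ = 1 := fun N l => by rw [norm_pow, hω, one_pow]
  let G : ℕ → C(bidisk, ℂ) := fun N => ((N : ℂ) + 1)⁻¹ •
    ∑ l ∈ Finset.range (N + 1), (ω N ^ l) ^ (-n) • F.comp (rot (ω N ^ l) (hωl N l))
  -- In degree `k` the average `G N` has the factor `1` if `N + 1` divides `k - n`, and `0` if not.
  let χ : ℕ → ℤ → ℂ := fun N k => ((N : ℂ) + 1)⁻¹ *
    ∑ l ∈ Finset.range (N + 1), (ω N ^ (k - n)) ^ l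
  have hGY : ∀ N, G N ∈ Y := fun N => Y.smul_mem _ <| Y.sum_mem fun l _ =>
    Y.smul_mem _ (hrot _ _ F hF)
  have hGc : ∀ N, HasCoeffs (G N) (twist (χ N) a) := by
    intro N
    have h0 : ω N ≠ 0 := norm_pos_iff.1 (by rw [hω]; exact one_pos)
    have h := (HasCoeffs.sum (Finset.range (N + 1)) fun l _ =>
      ((ha.rot (hωl N l)).smul ((ω N ^ l) ^ (-n)))).smul ((N : ℂ) + 1)⁻¹
    convert h using 1
    funext i
    simp only [twist, χ, Pi.smul_apply, Finset.sum_apply, smul_eq_mul, mul_assoc, Finset.sum_mul]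
    congr 1
    refine Finset.sum_congr rfl fun l _ => ?_
    rw [← mul_assoc, ← zpow_natCast, ← zpow_mul, ← zpow_natCast, ← zpow_mul, ← zpow_mul,
      ← zpow_add₀ h0]
    congr 2
    ring
  have hN : ∀ N : ℕ, ((N : ℂ) + 1) ≠ 0 := fun N => Nat.cast_add_one_ne_zero N
  have hχb : ∀ N k, ‖χ N k‖ ≤ 1 := by
    intro N k
    have h1 : ‖∑ l ∈ Finset.range (N + 1), (ω N ^ (k - n)) ^ l‖ ≤ (N : ℝ) + 1 := by
      refine (norm_sum_le _ _).trans ?_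
      simp [hω]
    have h2 : ‖((N : ℂ) + 1)‖ = (N : ℝ) + 1 := by
      exact_mod_cast Complex.norm_natCast (N + 1)
    rw [norm_mul, norm_inv, h2]
    exact inv_mul_le_one_of_le₀ h1 (by positivity)
  have hχlim : ∀ k, Filter.Tendsto (fun N => χ N k) Filter.atTop (nhds (deltaAt n k)) := by
    intro k
    refine tendsto_const_nhds.congr' ?_
    filter_upwards [Filter.eventually_ge_atTop (k - n).natAbs] with N hNk
    by_cases hk : k = n
    · subst hk
      simp [χ, deltaAt, hN N]
    · have h1 : ω N ^ (k - n) ≠ 1 := by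
        rw [Ne, (hprim N).zpow_eq_one_iff_dvd]
        intro hd
        have := Int.le_of_dvd (abs_pos.2 (sub_ne_zero.2 hk)) ((dvd_abs _ _).2 hd)
        rw [Int.abs_eq_natAbs] at this
        omega
      have h2 : (ω N ^ (k - n)) ^ (N + 1) = 1 := by
        rw [← zpow_natCast, zpow_comm, zpow_natCast, (hprim N).pow_eq_one, one_zpow]
      simp [χ, deltaAt, hk, geom_sum_eq h1, h2]
  exact hYc.mem_of_tendsto (tendsto_of_twist ha.1 hχb hχlim hGc (hasCoeffs_evMap _))
    (Filter.Eventually.of_forall hGY)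

/-- The eigenfunctions whose boundary coefficients are supported in the set `S` of degrees. -/
def modeSpace (lam : ℂ) (S : Set ℤ) : Submodule ℂ C(bidisk, ℂ) where
  carrier := {F | ∃ a, HasCoeffs F a ∧ EigenCoeffs lam a ∧ ∀ n ∉ S, bd a n = 0}
  zero_mem' := ⟨0, .zero, HasCoeffs.zero.mem_eigenspace_iff.1 (Submodule.zero_mem _),
    fun _ _ => rfl⟩
  add_mem' := by
    rintro F G ⟨a, hF, ha, ha'⟩ ⟨b, hG, hb, hb'⟩
    refine ⟨a + b, hF.add hG, (hF.add hG).mem_eigenspace_iff.1 (Submodule.add_mem _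
      (hF.mem_eigenspace_iff.2 ha) (hG.mem_eigenspace_iff.2 hb)), fun n hn => ?_⟩
    have h1 := ha' n hn
    have h2 := hb' n hn
    simp_all [bd]
  smul_mem' := by
    rintro c F ⟨a, hF, ha, ha'⟩
    refine ⟨c • a, hF.smul c, (hF.smul c).mem_eigenspace_iff.1 (Submodule.smul_mem _ c
      (hF.mem_eigenspace_iff.2 ha)), fun n hn => ?_⟩
    have h1 := ha' n hn
    simp_all [bd]

theorem HasCoeffs.mem_modeSpace_iff {F : C(bidisk, ℂ)} {a : ℕ × ℕ → ℂ} (h : HasCoeffs F a)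
    {lam : ℂ} {S : Set ℤ} :
    F ∈ modeSpace lam S ↔ EigenCoeffs lam a ∧ ∀ n ∉ S, bd a n = 0 := by
  constructor
  · rintro ⟨b, hb, h1, h2⟩
    rw [h.unique hb]
    exact ⟨h1, h2⟩
  · rintro ⟨h1, h2⟩
    exact ⟨a, h, h1, h2⟩

theorem modeSpace_le_eigenspace (lam : ℂ) (S : Set ℤ) : modeSpace lam S ≤ eigenspace lam := by
  rintro F ⟨a, hF, ha, -⟩
  exact hF.mem_eigenspace_iff.2 ha

theorem modeSpace_univ (lam : ℂ) : modeSpace lam Set.univ = eigenspace lam := by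
  refine le_antisymm (modeSpace_le_eigenspace _ _) fun F hF => ?_
  obtain ⟨a, ha, hE⟩ := exists_of_mem_eigenspace hF
  exact ⟨a, ha, hE, by simp⟩

theorem modeSpace_empty (lam : ℂ) : modeSpace lam ∅ = ⊥ := by
  refine (Submodule.eq_bot_iff _).2 ?_
  rintro F ⟨a, hF, ha, h⟩
  rw [ha.eq_zero fun n => h n (Set.notMem_empty n)] at hF
  exact hF.ext .zero

theorem modeSpace_inter (lam : ℂ) (S T : Set ℤ) :
    modeSpace lam (S ∩ T) = modeSpace lam S ⊓ modeSpace lam T := by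
  refine le_antisymm ?_ ?_
  · rintro F ⟨a, hF, ha, h⟩
    exact ⟨⟨a, hF, ha, fun n hn => h n fun h => hn h.1⟩,
      ⟨a, hF, ha, fun n hn => h n fun h => hn h.2⟩⟩
  · rintro F ⟨⟨a, hF, ha, h⟩, hT⟩
    refine ⟨a, hF, ha, fun n hn => ?_⟩
    by_cases hS : n ∈ S
    · exact (hF.mem_modeSpace_iff.1 hT).2 n fun h => hn ⟨hS, h⟩
    · exact h n hS

theorem mem_modeSpace_swap {lam : ℂ} {S : Set ℤ} {F : C(bidisk, ℂ)} (hF : F ∈ modeSpace lam S) :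
    F.comp bidiskSwap ∈ modeSpace lam (-S) := by
  obtain ⟨a, hF, ha, h⟩ := hF
  exact ⟨_, hF.swap, ha.swap, fun n hn => by rw [bd_swap]; exact h _ hn⟩

/-- `G` is a non-zero eigenfunction that is homogeneous of degree `n`. -/
def IsMode (lam : ℂ) (n : ℤ) (G : C(bidisk, ℂ)) : Prop :=
  ∃ b, HasCoeffs G b ∧ EigenCoeffs lam b ∧ (∀ k ≠ n, bd b k = 0) ∧ bd b n ≠ 0

/-- A closed subspace that contains modes of all degrees in `S` contains all eigenfunctions with
degrees in `S`, since these are the limits of the partial sums of their homogeneous components. -/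
theorem modeSpace_le {lam : ℂ} {S : Set ℤ} {Y : Submodule ℂ C(bidisk, ℂ)}
    (hYc : IsClosed (Y : Set C(bidisk, ℂ))) (h : ∀ n ∈ S, ∃ G ∈ Y, IsMode lam n G) :
    modeSpace lam S ≤ Y := by
  rintro F ⟨a, hF, ha, hS⟩
  let E : ℤ → C(bidisk, ℂ) := fun n =>
    evMap (twist (deltaAt n) a) (hF.1.twist (norm_deltaAt_le n))
  have hE : ∀ n, HasCoeffs (E n) (twist (deltaAt n) a) := fun n => hasCoeffs_evMap _
  have hEY : ∀ n, E n ∈ Y := by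
    intro n
    by_cases hn : n ∈ S
    · obtain ⟨G, hGY, b, hG, hb, hb0, hbn⟩ := h n hn
      have : E n = (bd a n / bd b n) • G := by
        refine eq_of_bd_eq (hE n) (hG.smul _) (ha.twist _) ((hG.smul _).mem_eigenspace_iff.1
          (Submodule.smul_mem _ _ (hG.mem_eigenspace_iff.2 hb))) fun k => ?_
        rw [bd_twist, show bd ((bd a n / bd b n) • b) k = bd a n / bd b n * bd b k from rfl]
        by_cases hk : k = n
        · subst hk
          simp [deltaAt, hbn]
        · simp [deltaAt, hk, hb0 k hk]
      rw [this]
      exact Y.smul_mem _ hGY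
    · have h0 : twist (deltaAt n) a = 0 := (ha.twist _).eq_zero fun k => by
        rw [bd_twist, deltaAt]
        split_ifs with hk
        · rw [hk, hS n hn, mul_zero]
        · rw [zero_mul]
      have := hE n
      rw [h0] at this
      rw [this.ext .zero]
      exact Y.zero_mem
  let χ : ℕ → ℤ → ℂ := fun N k => ∑ n ∈ Finset.Icc (-(N : ℤ)) N, deltaAt n k
  have hχ : ∀ N k, χ N k = if k ∈ Finset.Icc (-(N : ℤ)) N then 1 else 0 := fun N k => by
    simp only [χ, deltaAt, Finset.sum_ite_eq]
  refine hYc.mem_of_tendsto (f := fun N : ℕ => ∑ n ∈ Finset.Icc (-(N : ℤ)) N, E n)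
    (tendsto_of_twist hF.1 (χ := χ) (χ' := fun _ => 1) ?_ ?_ ?_ ?_)
    (Filter.Eventually.of_forall fun N => Y.sum_mem fun n _ => hEY n)
  · intro N k
    rw [hχ]
    split_ifs <;> simp
  · intro k
    refine tendsto_const_nhds.congr' ?_
    filter_upwards [Filter.eventually_ge_atTop k.natAbs] with N hN
    rw [hχ, if_pos]
    rw [Finset.mem_Icc]
    omega
  · intro N
    convert HasCoeffs.sum (Finset.Icc (-(N : ℤ)) N) fun n _ => hE n using 1
    funext i
    simp [twist, χ, Finset.sum_mul]
  · convert hF using 1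
    funext i
    simp [twist]

/-- The degrees occurring in the elements of `Y`. -/
def modeSet (Y : Submodule ℂ C(bidisk, ℂ)) : Set ℤ :=
  {n | ∃ F ∈ Y, ∃ a, HasCoeffs F a ∧ bd a n ≠ 0}

theorem exists_isMode {lam : ℂ} {Y : Submodule ℂ C(bidisk, ℂ)} (hY : Y ≤ eigenspace lam)
    (hYc : IsClosed (Y : Set C(bidisk, ℂ)))
    (hrot : ∀ (ω : ℂ) (hω : ‖ω‖ = 1), ∀ F ∈ Y, F.comp (rot ω hω) ∈ Y) {n : ℤ}
    (hn : n ∈ modeSet Y) : ∃ G ∈ Y, IsMode lam n G := by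
  obtain ⟨F, hF, a, ha, han⟩ := hn
  refine ⟨_, component_mem hYc hrot hF ha n, twist (deltaAt n) a, hasCoeffs_evMap _,
    (ha.mem_eigenspace_iff.1 (hY hF)).twist _, fun k hk => ?_, ?_⟩
  · simp [bd_twist, deltaAt, hk]
  · simpa [bd_twist, deltaAt] using han

/-- A closed rotation invariant space of eigenfunctions is determined by the degrees occurring in
it. -/
theorem eq_modeSpace {lam : ℂ} {Y : Submodule ℂ C(bidisk, ℂ)} (hY : Y ≤ eigenspace lam)
    (hYc : IsClosed (Y : Set C(bidisk, ℂ)))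
    (hrot : ∀ (ω : ℂ) (hω : ‖ω‖ = 1), ∀ F ∈ Y, F.comp (rot ω hω) ∈ Y) :
    Y = modeSpace lam (modeSet Y) := by
  refine le_antisymm (fun F hF => ?_) (modeSpace_le hYc fun n hn => exists_isMode hY hYc hrot hn)
  obtain ⟨a, ha, hE⟩ := exists_of_mem_eigenspace (hY hF)
  refine ⟨a, ha, hE, fun n hn => ?_⟩
  by_contra h
  exact hn ⟨F, hF, a, ha, h⟩

/-! ### Möbius maps of the bidisk -/

/-- `T` is of the form `(z, w) ↦ (ψ(z), 1 / ψ(1 / w))` for the fractional linear map `ψ` with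
matrix `!![α, β; γ, δ]`, where it is not required that `ψ` preserves the disk. Interchanging the two
coordinates before and after applying `T` exchanges `α` with `δ` and `β` with `γ`. -/
def IsFractionalMap (T : C(bidisk, bidisk)) : Prop :=
  ∃ α β γ δ : ℂ, α * δ - β * γ ≠ 0 ∧ ∀ p : bidisk,
    γ * p.1.1 + δ ≠ 0 ∧ α + β * p.1.2 ≠ 0 ∧
      (T p).1.1 = (α * p.1.1 + β) / (γ * p.1.1 + δ) ∧
      (T p).1.2 = (γ + δ * p.1.2) / (α + β * p.1.2)

theorem smul_coe_eq_iff (g : GL (Fin 2) ℂ) (x y : ℂ) :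
    (y : OnePoint ℂ) = g • (x : OnePoint ℂ) ↔
      g 1 0 * x + g 1 1 ≠ 0 ∧ y = (g 0 0 * x + g 0 1) / (g 1 0 * x + g 1 1) := by
  rw [OnePoint.smul_some_eq_ite]
  split_ifs with h
  · simp [h]
  · simp only [h, ne_eq, not_false_eq_true, true_and]
    exact OnePoint.coe_eq_coe

theorem invMatrix_smul_coe_eq_iff (g : GL (Fin 2) ℂ) (x y : ℂ) :
    (y : OnePoint ℂ) = invMatrix • g • invMatrix • (x : OnePoint ℂ) ↔
      g 0 0 + g 0 1 * x ≠ 0 ∧ y = (g 1 0 + g 1 1 * x) / (g 0 0 + g 0 1 * x) := by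
  rw [← mul_smul, ← mul_smul, smul_coe_eq_iff]
  have h : ((invMatrix * (g * invMatrix) : GL (Fin 2) ℂ) : Matrix (Fin 2) (Fin 2) ℂ) =
      !![g 1 1, g 1 0; g 0 1, g 0 0] := by
    have h1 : ((invMatrix : GL (Fin 2) ℂ) : Matrix (Fin 2) (Fin 2) ℂ) = !![0, 1; 1, 0] := rfl
    rw [Units.val_mul, Units.val_mul, h1, Matrix.eta_fin_two (g : Matrix (Fin 2) (Fin 2) ℂ)]
    simp
  simp only [← mul_assoc] at h ⊢
  rw [h]
  simp [add_comm]

theorem IsMoebius.isFractionalMap {T : C(bidisk, bidisk)} (hT : IsMoebius T) :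
    IsFractionalMap T := by
  obtain ⟨g, -, hg⟩ := hT
  refine ⟨g 0 0, g 0 1, g 1 0, g 1 1, ?_, fun p => ?_⟩
  · have := g.det_ne_zero
    rwa [Matrix.det_fin_two] at this
  · obtain ⟨h1, h2⟩ := hg p
    rw [smul_coe_eq_iff] at h1
    rw [invMatrix_smul_coe_eq_iff] at h2
    exact ⟨h1.1, h2.1, h1.2, h2.2⟩

theorem IsFractionalMap.conj_swap {T : C(bidisk, bidisk)} (hT : IsFractionalMap T) :
    IsFractionalMap (bidiskSwap.comp (T.comp bidiskSwap)) := by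
  obtain ⟨α, β, γ, δ, hdet, h⟩ := hT
  refine ⟨δ, γ, β, α, by rwa [mul_comm δ, mul_comm γ], fun p => ?_⟩
  obtain ⟨h1, h2, h3, h4⟩ := h (bidiskSwap p)
  refine ⟨?_, ?_, ?_, ?_⟩
  · rw [add_comm]
    exact h2
  · rw [add_comm]
    exact h1
  · rw [add_comm (δ * _), add_comm (β * _)]
    exact h4
  · rw [add_comm β, add_comm δ]
    exact h3

/-- A fractional linear map multiplies `1 - zw` by a product of functions of `z` and of `w`. -/
theorem one_sub_mul_fractional {α β γ δ z w : ℂ} (h1 : γ * z + δ ≠ 0) (h2 : α + β * w ≠ 0) :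
    1 - (α * z + β) / (γ * z + δ) * ((γ + δ * w) / (α + β * w)) =
      (α * δ - β * γ) * (1 - z * w) / ((γ * z + δ) * (α + β * w)) := by
  have h := mul_ne_zero h1 h2
  rw [div_mul_div_comm, eq_div_iff h, sub_mul, one_mul, div_mul_cancel₀ _ h]
  ring

theorem hasDerivAt_fractional {α β γ δ z : ℂ} (h : γ * z + δ ≠ 0) :
    HasDerivAt (fun z => (α * z + β) / (γ * z + δ)) ((α * δ - β * γ) / (γ * z + δ) ^ 2) z := by
  have h1 : HasDerivAt (fun z => α * z + β) α z := by
    simpa using ((hasDerivAt_id z).const_mul α).add_const β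
  have h2 : HasDerivAt (fun z => γ * z + δ) γ z := by
    simpa using ((hasDerivAt_id z).const_mul γ).add_const δ
  refine (h1.div h2 h).congr_deriv ?_
  ring

/-- `X_λ` is invariant, since `(1 - zw)² ψ'(z) χ'(w) = (1 - ψ(z) χ(w))²` for a fractional linear map
`(z, w) ↦ (ψ(z), χ(w))`. -/
theorem eigenspace_comp_mem {lam : ℂ} {F : C(bidisk, ℂ)} (hF : F ∈ eigenspace lam)
    {T : C(bidisk, bidisk)} (hT : IsFractionalMap T) : F.comp T ∈ eigenspace lam := by
  obtain ⟨a, ha, -⟩ := exists_of_mem_eigenspace hF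
  obtain ⟨α, β, γ, δ, hdet, h⟩ := hT
  have hT' : ∀ p (hp : p ∈ bidisk), (T ⟨p, hp⟩ : ℂ × ℂ) =
      ((α * p.1 + β) / (γ * p.1 + δ), (δ * p.2 + γ) / (β * p.2 + α)) := fun p hp => by
    rw [add_comm (δ * p.2), add_comm (β * p.2)]
    exact Prod.ext (h ⟨p, hp⟩).2.2.1 (h ⟨p, hp⟩).2.2.2
  set ψ : ℂ → ℂ := fun z => (α * z + β) / (γ * z + δ) with hψ
  set χ : ℂ → ℂ := fun w => (δ * w + γ) / (β * w + α) with hχ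
  have hmaps : ∀ p ∈ bidisk, (ψ p.1, χ p.2) ∈ bidisk := fun p hp => by
    rw [← hT' p hp]
    exact (T ⟨p, hp⟩).2
  have hψ' : ∀ p ∈ bidisk, HasDerivAt ψ ((α * δ - β * γ) / (γ * p.1 + δ) ^ 2) p.1 :=
    fun p hp => hasDerivAt_fractional (h ⟨p, hp⟩).1
  have hχ' : ∀ p ∈ bidisk, HasDerivAt χ ((δ * α - γ * β) / (β * p.2 + α) ^ 2) p.2 :=
    fun p hp => hasDerivAt_fractional (by rw [add_comm]; exact (h ⟨p, hp⟩).2.1)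
  have hFT : ∀ p ∈ bidisk, extZero (F.comp T) p = ev a (ψ p.1, χ p.2) := fun p hp => by
    rw [extZero_apply (F.comp T) ⟨p, hp⟩, ContinuousMap.comp_apply, ha.2, hT' p hp]
  constructor
  · intro p hp
    have h1 : DifferentiableAt ℂ (fun p : ℂ × ℂ => ψ p.1) p :=
      (hψ' p hp).differentiableAt.comp p differentiableAt_fst
    have h2 : DifferentiableAt ℂ (fun p : ℂ × ℂ => χ p.2) p :=
      (hχ' p hp).differentiableAt.comp p differentiableAt_snd
    have h3 : DifferentiableAt ℂ (ev a) (ψ p.1, χ p.2) :=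
      (differentiableOn_ev ha.1).differentiableAt (isOpen_bidisk.mem_nhds (hmaps p hp))
    refine DifferentiableWithinAt.congr ?_ hFT (hFT p hp)
    exact (DifferentiableAt.comp p h3 (h1.prodMk h2)).differentiableWithinAt
  · rintro ⟨⟨z, w⟩, hp⟩
    have hz := (h ⟨_, hp⟩).1
    have hw := (h ⟨_, hp⟩).2.1
    have hEF := hF.2 (T ⟨_, hp⟩)
    rw [ContinuousMap.comp_apply, ← hEF, hT' _ hp,
      invLaplacian_congr (fun q hq => ha.extZero_eq hq) (hmaps _ hp),
      invLaplacian_ev ha.1 (hmaps _ hp), invLaplacian_congr hFT hp, invLaplacian]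
    have hev : (fun z' => deriv (fun w' => ev a (ψ z', χ w')) w) =ᶠ[nhds z]
        fun z' => ev (derSnd a) (ψ z', χ w) * ((δ * α - γ * β) / (β * w + α) ^ 2) := by
      filter_upwards [isOpen_ball.mem_nhds hp.1] with z' hz'
      exact ((hasDerivAt_ev_snd ha.1 (hmaps (z', w) ⟨hz', hp.2⟩)).comp w
        (hχ' (z', w) ⟨hz', hp.2⟩)).deriv
    have hd : HasDerivAt (fun z' => ev (derSnd a) (ψ z', χ w) *
        ((δ * α - γ * β) / (β * w + α) ^ 2)) _ z :=
      ((hasDerivAt_ev_fst ha.1.derSnd (hmaps _ hp)).comp z (hψ' _ hp)).mul_const _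
    rw [hev.deriv_eq, hd.deriv]
    simp only [hψ, hχ]
    simp only at hz hw
    rw [add_comm (δ * w), add_comm (β * w), one_sub_mul_fractional hz hw]
    generalize ev (derFst (derSnd a)) _ = E
    generalize γ * z + δ = d at hz ⊢
    generalize α + β * w = e at hw ⊢
    field_simp

/-! ### A Möbius invariant polynomial condition in `z` -/

/-- Polynomial functions of degree at most `m` on the unit disk. -/
def polyFun (m : ℕ) : Submodule ℂ (ball (0 : ℂ) 1 → ℂ) :=
  (Polynomial.degreeLT ℂ (m + 1)).map
    (LinearMap.pi fun z : ball (0 : ℂ) 1 => Polynomial.leval (z : ℂ))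

theorem mem_polyFun {m : ℕ} {f : ball (0 : ℂ) 1 → ℂ} :
    f ∈ polyFun m ↔ ∃ P : Polynomial ℂ, P.natDegree ≤ m ∧ ∀ z, f z = P.eval (z : ℂ) := by
  simp only [polyFun, Submodule.mem_map, Polynomial.mem_degreeLT]
  constructor
  · rintro ⟨P, hP, rfl⟩
    refine ⟨P, ?_, fun z => rfl⟩
    rcases eq_or_ne P 0 with rfl | h0
    · simp
    · exact Nat.lt_succ_iff.1 ((Polynomial.natDegree_lt_iff_degree_lt h0).2 hP)
  · rintro ⟨P, hP, h⟩
    refine ⟨P, ?_, funext fun z => (h z).symm⟩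
    exact (Polynomial.natDegree_le_iff_degree_le.1 hP).trans_lt (by exact_mod_cast m.lt_succ_self)

instance (m : ℕ) : FiniteDimensional ℂ (polyFun m) := by
  have : FiniteDimensional ℂ (Polynomial.degreeLT ℂ (m + 1)) :=
    (Polynomial.degreeLTEquiv ℂ (m + 1)).symm.finiteDimensional
  unfold polyFun
  infer_instance

/-- The linear map sending `F` to the function `z ↦ (1 - zw)^m F(z, w)` on the disk. -/
def slice (m : ℕ) (w : ball (0 : ℂ) 1) : C(bidisk, ℂ) →ₗ[ℂ] (ball (0 : ℂ) 1 → ℂ) where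
  toFun F z := (1 - (z : ℂ) * w) ^ m * F ⟨(z, w), z.2, w.2⟩
  map_add' F G := funext fun z => mul_add _ _ _
  map_smul' c F := funext fun z => by simp [mul_left_comm]

/-- The space of all `F` such that `(1 - zw)^m F(z, w)` is a polynomial in `z` of degree at most
`m` for every `w`. -/
def growthSpace (m : ℕ) : Submodule ℂ C(bidisk, ℂ) := ⨅ w, (polyFun m).comap (slice m w)

theorem mem_growthSpace {m : ℕ} {F : C(bidisk, ℂ)} :
    F ∈ growthSpace m ↔ ∀ w : ball (0 : ℂ) 1, ∃ P : Polynomial ℂ, P.natDegree ≤ m ∧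
      ∀ z : ball (0 : ℂ) 1,
        (1 - (z : ℂ) * w) ^ m * F ⟨(z, w), z.2, w.2⟩ = P.eval (z : ℂ) := by
  simp only [growthSpace, Submodule.mem_iInf, Submodule.mem_comap, mem_polyFun]
  rfl

theorem isClosed_growthSpace (m : ℕ) : IsClosed (growthSpace m : Set C(bidisk, ℂ)) := by
  rw [growthSpace, Submodule.coe_iInf]
  refine isClosed_iInter fun w => ?_
  have hc : Continuous (slice m w) := continuous_pi fun z =>
    continuous_const.mul (ContinuousEvalConst.continuous_eval_const _)
  exact (Submodule.closed_of_finiteDimensional (polyFun m)).preimage hc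

/-- If `P` has degree at most `m`, then so has `B ^ m * P(A / B)` for linear `A` and `B`. -/
theorem exists_homogenize {m : ℕ} {P : Polynomial ℂ} (hP : P.natDegree ≤ m) (α β γ δ : ℂ) :
    ∃ Q : Polynomial ℂ, Q.natDegree ≤ m ∧ ∀ z, γ * z + δ ≠ 0 →
      Q.eval z = (γ * z + δ) ^ m * P.eval ((α * z + β) / (γ * z + δ)) := by
  refine ⟨∑ i ∈ Finset.range (m + 1), Polynomial.C (P.coeff i) *
    ((Polynomial.C α * Polynomial.X + Polynomial.C β) ^ i *
      (Polynomial.C γ * Polynomial.X + Polynomial.C δ) ^ (m - i)), ?_, fun z hz => ?_⟩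
  · refine Polynomial.natDegree_sum_le_of_forall_le _ _ fun i hi => ?_
    have hi' : i ≤ m := by simpa [Nat.lt_succ_iff] using hi
    refine (Polynomial.natDegree_C_mul_le _ _).trans ((Polynomial.natDegree_mul_le).trans ?_)
    have h1 := Polynomial.natDegree_pow_le_of_le i
      (Polynomial.natDegree_linear_le (a := α) (b := β))
    have h2 := Polynomial.natDegree_pow_le_of_le (m - i)
      (Polynomial.natDegree_linear_le (a := γ) (b := δ))
    omega
  · rw [Polynomial.eval_eq_sum_range' (Nat.lt_succ_of_le hP), Finset.mul_sum,
      Polynomial.eval_finsetSum]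
    refine Finset.sum_congr rfl fun i hi => ?_
    have hi' : i ≤ m := by simpa [Nat.lt_succ_iff] using hi
    simp only [Polynomial.eval_mul, Polynomial.eval_C, Polynomial.eval_pow, Polynomial.eval_add,
      Polynomial.eval_X, div_pow]
    rw [← Nat.sub_add_cancel hi', Nat.add_sub_cancel, pow_add]
    generalize γ * z + δ = d at hz
    field_simp

/-- Up to a factor depending on `w`, passing to `F ∘ T` turns the polynomial `P` of the slice into
`(γ z + δ)^m P((α z + β) / (γ z + δ))`, again a polynomial of degree at most `m`. -/
theorem growthSpace_comp_mem {m : ℕ} {F : C(bidisk, ℂ)} (hF : F ∈ growthSpace m)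
    {T : C(bidisk, bidisk)} (hT : IsFractionalMap T) : F.comp T ∈ growthSpace m := by
  obtain ⟨α, β, γ, δ, hdet, h⟩ := hT
  rw [mem_growthSpace] at hF ⊢
  intro w
  obtain ⟨P, hP, hPF⟩ := hF ⟨(T ⟨(0, w), by simp, w.2⟩).1.2, (T ⟨(0, w), by simp, w.2⟩).2.2⟩
  obtain ⟨Q, hQ, hQP⟩ := exists_homogenize hP α β γ δ
  refine ⟨Polynomial.C (((α + β * w) / (α * δ - β * γ)) ^ m) * Q,
    (Polynomial.natDegree_C_mul_le _ _).trans hQ, fun z => ?_⟩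
  obtain ⟨h1, h2, h3, h4⟩ := h ⟨(z, w), z.2, w.2⟩
  have h5 := (h ⟨(0, w), by simp, w.2⟩).2.2.2
  have hTz : (T ⟨(z, w), z.2, w.2⟩).1 =
      ((T ⟨(z, w), z.2, w.2⟩).1.1, (T ⟨(0, w), by simp, w.2⟩).1.2) :=
    Prod.ext rfl (h4.trans h5.symm)
  have hPz := hPF ⟨(T ⟨(z, w), z.2, w.2⟩).1.1, (T ⟨(z, w), z.2, w.2⟩).2.1⟩
  simp only [← hTz, Subtype.coe_eta] at hPz
  rw [h5, h3, one_sub_mul_fractional h1 h2] at hPz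
  rw [Polynomial.eval_mul, Polynomial.eval_C, hQP _ h1, ContinuousMap.comp_apply]
  simp only at hPz h1 h2 ⊢
  rw [← hPz]
  simp only [div_pow, mul_pow]
  generalize γ * (z : ℂ) + δ = d at h1 ⊢
  generalize α + β * (w : ℂ) = e at h2 ⊢
  field_simp

/-- If `∑ a (j, 0) z ^ j` is a polynomial function, then its coefficients are those of the
polynomial. -/
theorem coeff_of_eval {a : ℕ × ℕ → ℂ} (ha : AbsConv a) {P : Polynomial ℂ}
    (h : ∀ z ∈ ball (0 : ℂ) 1, ev a (z, 0) = P.eval z) (j : ℕ) : a (j, 0) = P.coeff j := by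
  induction j generalizing a P with
  | zero =>
    rw [Polynomial.coeff_zero_eq_eval_zero, ← h 0 (by simp), ev, tsum_eq_single (0, 0)]
    · simp
    · rintro ⟨j, k⟩ hjk
      cases j <;> cases k <;> simp_all
  | succ j ih =>
    have hd : ∀ z ∈ ball (0 : ℂ) 1, ev (derFst a) (z, 0) = (Polynomial.derivative P).eval z := by
      intro z hz
      have hev : (fun z => ev a (z, 0)) =ᶠ[nhds z] fun z => P.eval z := by
        filter_upwards [isOpen_ball.mem_nhds hz] with z' hz' using h z' hz'
      rw [← (hasDerivAt_ev_fst ha ⟨hz, by simp⟩).deriv, hev.deriv_eq, Polynomial.deriv]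
    have := ih ha.derFst hd
    rw [Polynomial.coeff_derivative, mul_comm] at this
    exact mul_left_cancel₀ (Nat.cast_add_one_ne_zero j) this

theorem bd_eq_zero_of_mem_growthSpace {m : ℕ} {F : C(bidisk, ℂ)} (hF : F ∈ growthSpace m)
    {a : ℕ × ℕ → ℂ} (ha : HasCoeffs F a) {n : ℤ} (hn : (m : ℤ) < n) : bd a n = 0 := by
  obtain ⟨P, hP, hPF⟩ := mem_growthSpace.1 hF ⟨0, by simp⟩
  lift n to ℕ using by omega
  rw [bd_natCast, coeff_of_eval ha.1 (P := P)]
  · exact Polynomial.coeff_eq_zero_of_natDegree_lt (by omega)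
  · intro z hz
    rw [← hPF ⟨z, hz⟩, ha.2]
    simp

/-! ### The eigenfunction built from a Bessel polynomial -/

/-- The coefficients of the solution `p` with `p(0) = 1` of the Bessel polynomial equation
`u² p'' + 2 u p' + p' = m (m + 1) p`. -/
def besselCoeff (m : ℕ) : ℕ → ℂ
  | 0 => 1
  | k + 1 => (m * (m + 1) - k * (k + 1)) / (k + 1) * besselCoeff m k

/-- The reversed Bessel polynomial of degree `m`. -/
def besselPoly (m : ℕ) : Polynomial ℂ :=
  ∑ k ∈ Finset.range (m + 1), Polynomial.C (besselCoeff m k) * Polynomial.X ^ k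

theorem besselCoeff_eq_zero {m k : ℕ} (h : m < k) : besselCoeff m k = 0 := by
  induction k, h using Nat.le_induction with
  | base => simp [besselCoeff]
  | succ k _ ih => simp [besselCoeff, ih]

theorem coeff_besselPoly (m k : ℕ) : (besselPoly m).coeff k = besselCoeff m k := by
  simp only [besselPoly, Polynomial.finsetSum_coeff, Polynomial.coeff_C_mul_X_pow,
    Finset.sum_ite_eq, Finset.mem_range]
  split_ifs with h
  · rfl
  · exact (besselCoeff_eq_zero (by omega)).symm

theorem natDegree_besselPoly_le (m : ℕ) : (besselPoly m).natDegree ≤ m :=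
  Polynomial.natDegree_le_iff_coeff_eq_zero.2 fun k hk => by
    rw [coeff_besselPoly, besselCoeff_eq_zero (by omega)]

theorem besselPoly_equation (m : ℕ) (u : ℂ) :
    u ^ 2 * (besselPoly m).derivative.derivative.eval u +
      2 * u * (besselPoly m).derivative.eval u + (besselPoly m).derivative.eval u =
      m * (m + 1) * (besselPoly m).eval u := by
  have h : Polynomial.X ^ 2 * (besselPoly m).derivative.derivative +
      Polynomial.C 2 * (Polynomial.X * (besselPoly m).derivative) + (besselPoly m).derivative =
      Polynomial.C ((m : ℂ) * (m + 1)) * besselPoly m := by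
    have hk : ∀ k : ℕ, (k : ℂ) + 1 ≠ 0 := fun k => Nat.cast_add_one_ne_zero k
    ext k
    simp only [Polynomial.coeff_add, Polynomial.coeff_C_mul, Polynomial.coeff_X_pow_mul']
    rcases k with _ | _ | k
    · simp [Polynomial.coeff_derivative, coeff_besselPoly, besselCoeff]
    · have h1 := hk 1
      simp [Polynomial.coeff_derivative, coeff_besselPoly, besselCoeff, Polynomial.coeff_X_mul]
      field_simp
      ring
    · have h1 := hk (k + 2)
      rw [if_pos (by omega), Polynomial.coeff_X_mul]
      simp only [Polynomial.coeff_derivative, coeff_besselPoly, besselCoeff]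
      push_cast at h1 ⊢
      field_simp
      ring
  have := congrArg (Polynomial.eval u) h
  simp only [Polynomial.eval_add, Polynomial.eval_mul, Polynomial.eval_C, Polynomial.eval_X,
    Polynomial.eval_pow] at this
  rw [← this]
  ring

theorem one_sub_mul_ne_zero {p : ℂ × ℂ} (hp : p ∈ bidisk) : 1 - p.1 * p.2 ≠ 0 := by
  obtain ⟨z, w⟩ := p
  obtain ⟨hz, hw⟩ := mem_bidisk.1 hp
  refine slitPlane_ne_zero (one_sub_mem_slitPlane ?_)
  rw [norm_mul]
  nlinarith [norm_nonneg z, norm_nonneg w]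

/-- The function `e^w p(z / (1 - zw))` for the Bessel polynomial `p` of degree `m`. -/
def besselMap (m : ℕ) : C(bidisk, ℂ) where
  toFun p := exp p.1.2 * (besselPoly m).eval (p.1.1 / (1 - p.1.1 * p.1.2))
  continuous_toFun := by
    refine Continuous.mul (by fun_prop) ((besselPoly m).continuous.comp ?_)
    exact Continuous.div (by fun_prop) (by fun_prop) fun p => one_sub_mul_ne_zero p.2

theorem besselMap_mem_growthSpace (m : ℕ) : besselMap m ∈ growthSpace m := by
  rw [mem_growthSpace]
  intro w
  obtain ⟨Q, hQ, hQP⟩ := exists_homogenize (natDegree_besselPoly_le m) 1 0 (-(w : ℂ)) 1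
  refine ⟨Polynomial.C (exp w) * Q, (Polynomial.natDegree_C_mul_le _ _).trans hQ, fun z => ?_⟩
  have hne : 1 - (z : ℂ) * w ≠ 0 := one_sub_mul_ne_zero (p := (z, w)) ⟨z.2, w.2⟩
  have heq : -(w : ℂ) * z + 1 = 1 - z * w := by ring
  rw [Polynomial.eval_mul, Polynomial.eval_C, hQP _ (by rwa [heq]), heq, one_mul, add_zero]
  simp only [besselMap, ContinuousMap.coe_mk]
  ring

theorem besselMap_mem_eigenspace (m : ℕ) : besselMap m ∈ eigenspace (4 * m * (m + 1)) := by
  set P := besselPoly m with hP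
  have hext : ∀ p ∈ bidisk, extZero (besselMap m) p =
      exp p.2 * P.eval (p.1 / (1 - p.1 * p.2)) := fun p hp => extZero_apply _ ⟨p, hp⟩
  constructor
  · intro p hp
    refine DifferentiableWithinAt.congr ?_ hext (hext p hp)
    have hne := one_sub_mul_ne_zero hp
    have h1 : DifferentiableAt ℂ (fun p : ℂ × ℂ => p.1 / (1 - p.1 * p.2)) p := by
      fun_prop (disch := exact hne)
    have h2 : DifferentiableAt ℂ (fun p : ℂ × ℂ => P.eval (p.1 / (1 - p.1 * p.2))) p :=
      DifferentiableAt.comp p P.differentiableAt h1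
    exact (DifferentiableAt.mul (by fun_prop) h2).differentiableWithinAt
  · rintro ⟨⟨z, w⟩, hp⟩
    have hne : 1 - z * w ≠ 0 := one_sub_mul_ne_zero hp
    have hw : ∀ z' ∈ ball (0 : ℂ) 1, HasDerivAt (fun w => z' / (1 - z' * w))
        ((z' / (1 - z' * w)) ^ 2) w := by
      intro z' hz'
      have hne' : 1 - z' * w ≠ 0 := one_sub_mul_ne_zero (p := (z', w)) ⟨hz', hp.2⟩
      have h1 : HasDerivAt (fun w => 1 - z' * w) (-z') w := by
        simpa using ((hasDerivAt_id w).const_mul z').const_sub 1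
      refine ((hasDerivAt_const w z').div h1 hne').congr_deriv ?_
      field_simp
      ring
    have hz : HasDerivAt (fun z => z / (1 - z * w)) (1 / (1 - z * w) ^ 2) z := by
      have h1 : HasDerivAt (fun z => 1 - z * w) (-w) z := by
        simpa using ((hasDerivAt_id z).mul_const w).const_sub 1
      refine ((hasDerivAt_id z).div h1 hne).congr_deriv ?_
      simp only [id]
      ring
    rw [invLaplacian_congr hext hp, invLaplacian]
    have hev : (fun z' => deriv (fun w' => exp w' * P.eval (z' / (1 - z' * w'))) w) =ᶠ[nhds z]
        fun z' => exp w * P.eval (z' / (1 - z' * w)) + exp w *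
          (P.derivative.eval (z' / (1 - z' * w)) * (z' / (1 - z' * w)) ^ 2) := by
      filter_upwards [isOpen_ball.mem_nhds hp.1] with z' hz'
      have h1 := (P.hasDerivAt (z' / (1 - z' * w))).comp w (hw z' hz')
      exact ((Complex.hasDerivAt_exp w).mul h1).deriv
    have h1 := (P.hasDerivAt (z / (1 - z * w))).comp z hz
    have h2 := (P.derivative.hasDerivAt (z / (1 - z * w))).comp z hz
    have hd : HasDerivAt (fun z' => exp w * P.eval (z' / (1 - z' * w)) + exp w *
          (P.derivative.eval (z' / (1 - z' * w)) * (z' / (1 - z' * w)) ^ 2)) _ z :=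
      (h1.const_mul (exp w)).add ((h2.mul (hz.pow 2)).const_mul (exp w))
    rw [hev.deriv_eq, hd.deriv]
    have hB := besselPoly_equation m (z / (1 - z * w))
    rw [← hP] at hB
    simp only [besselMap, ContinuousMap.coe_mk, ← hP, Function.comp_apply, Pi.pow_apply]
    set u := z / (1 - z * w) with hu
    generalize P.derivative.derivative.eval u = p2 at hB ⊢
    generalize P.derivative.eval u = p1 at hB ⊢
    generalize P.eval u = p0 at hB ⊢
    generalize exp w = e
    clear_value u
    generalize 1 - z * w = d at hne ⊢
    field_simp
    linear_combination e * hB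

/-- The property `ev a (0, w) = e^w` passes to the `w`-derivative, so every coefficient follows from
the constant one. -/
theorem coeff_ne_zero_of_exp {a : ℕ × ℕ → ℂ} (ha : AbsConv a)
    (h : ∀ w ∈ ball (0 : ℂ) 1, ev a (0, w) = exp w) (k : ℕ) : a (0, k) ≠ 0 := by
  induction k generalizing a with
  | zero =>
    have h0 := h 0 (by simp)
    rw [ev, tsum_eq_single (0, 0)] at h0
    · simp at h0
      simp [h0]
    · rintro ⟨j, k⟩ hjk
      cases j <;> cases k <;> simp_all
  | succ k ih =>
    have hd : ∀ w ∈ ball (0 : ℂ) 1, ev (derSnd a) (0, w) = exp w := by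
      intro w hw
      have hev : (fun w => ev a (0, w)) =ᶠ[nhds w] exp := by
        filter_upwards [isOpen_ball.mem_nhds hw] with w' hw' using h w' hw'
      rw [← (hasDerivAt_ev_snd ha ⟨by simp, hw⟩).deriv, hev.deriv_eq,
        (Complex.hasDerivAt_exp w).deriv]
    exact right_ne_zero_of_mul (ih ha.derSnd hd)

theorem bd_besselMap_ne_zero (m : ℕ) {a : ℕ × ℕ → ℂ} (ha : HasCoeffs (besselMap m) a) (k : ℕ) :
    bd a (-k) ≠ 0 := by
  rw [bd_neg_natCast]
  refine coeff_ne_zero_of_exp ha.1 (fun w hw => ?_) k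
  rw [← ha.2 ⟨(0, w), by simp, hw⟩]
  simp [besselMap, ← Polynomial.coeff_zero_eq_eval_zero, coeff_besselPoly, besselCoeff]

/-! ### The Möbius group and its infinitesimal action -/

/-- A fractional linear map and its inverse preserving the disk give a Möbius map of the bidisk. -/
theorem isMoebius_of_matrix {T : C(bidisk, bidisk)} (α β γ δ : ℂ) (hdet : α * δ - β * γ ≠ 0)
    (h1 : ∀ z ∈ ball (0 : ℂ) 1, γ * z + δ ≠ 0 ∧ (α * z + β) / (γ * z + δ) ∈ ball (0 : ℂ) 1)
    (h2 : ∀ z ∈ ball (0 : ℂ) 1, ∃ x ∈ ball (0 : ℂ) 1, z = (α * x + β) / (γ * x + δ))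
    (hT : ∀ p : bidisk, α + β * p.1.2 ≠ 0 ∧ (T p).1 =
      ((α * p.1.1 + β) / (γ * p.1.1 + δ), (γ + δ * p.1.2) / (α + β * p.1.2))) : IsMoebius T := by
  let g : GL (Fin 2) ℂ := Matrix.GeneralLinearGroup.mkOfDetNeZero !![α, β; γ, δ]
    (by rwa [Matrix.det_fin_two_of])
  have hg : ∀ z ∈ ball (0 : ℂ) 1,
      (((α * z + β) / (γ * z + δ) : ℂ) : OnePoint ℂ) = g • (z : OnePoint ℂ) := fun z hz =>
    (smul_coe_eq_iff g _ _).2 ⟨(h1 z hz).1, rfl⟩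
  refine ⟨g, ?_, fun p => ⟨?_, ?_⟩⟩
  · ext x
    constructor
    · rintro ⟨_, ⟨z, hz, rfl⟩, rfl⟩
      exact ⟨_, (h1 z hz).2, hg z hz⟩
    · rintro ⟨z, hz, rfl⟩
      obtain ⟨x, hx, rfl⟩ := h2 z hz
      exact ⟨_, ⟨x, hx, rfl⟩, (hg x hx).symm⟩
  · rw [(hT p).2]
    exact hg _ p.2.1
  · rw [(hT p).2]
    exact (invMatrix_smul_coe_eq_iff g _ _).2 ⟨(hT p).1, rfl⟩

theorem isMoebius_rot (ω : ℂ) (hω : ‖ω‖ = 1) : IsMoebius (rot ω hω) := by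
  have h0 : ω ≠ 0 := norm_pos_iff.1 (by rw [hω]; exact one_pos)
  refine isMoebius_of_matrix ω 0 0 1 (by simpa using h0) (fun z hz => ?_) (fun z hz => ?_)
    fun p => ?_
  · simpa [hω] using hz
  · refine ⟨ω⁻¹ * z, by simpa [hω] using hz, by simp [h0]⟩
  · simp [h0, rot, div_eq_inv_mul]

theorem one_sub_mul_ne_zero_of_norm_lt {t z : ℂ} (ht : ‖t‖ < 1) (hz : ‖z‖ < 1) : 1 - t * z ≠ 0 :=
  one_sub_mul_ne_zero (p := (t, z)) (mem_bidisk.2 ⟨ht, hz⟩)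

theorem norm_disk_map_lt {t : ℝ} (ht : ‖(t : ℂ)‖ < 1) {z : ℂ} (hz : ‖z‖ < 1) :
    ‖(z - t) / (1 - t * z)‖ < 1 := by
  have hne := one_sub_mul_ne_zero_of_norm_lt ht hz
  rw [norm_div, div_lt_one (norm_pos_iff.2 hne)]
  refine lt_of_pow_lt_pow_left₀ 2 (norm_nonneg _) ?_
  rw [← normSq_eq_norm_sq, ← normSq_eq_norm_sq, ← sub_pos]
  have h1 : t ^ 2 < 1 := by
    rw [norm_real, Real.norm_eq_abs] at ht
    exact (sq_lt_one_iff_abs_lt_one t).2 ht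
  have h2 : normSq z < 1 := by
    rw [normSq_eq_norm_sq]
    exact pow_lt_one₀ (norm_nonneg z) hz two_ne_zero
  have : normSq (1 - t * z) - normSq (z - t) = (1 - t ^ 2) * (1 - normSq z) := by
    simp [normSq_apply]
    ring
  rw [this]
  exact mul_pos (by linarith) (by linarith)

/-- The hyperbolic translation `(z, w) ↦ ((z - t) / (1 - tz), (w - t) / (1 - tw))` for real `t`. -/
def transl (t : ℝ) (ht : ‖(t : ℂ)‖ < 1) : C(bidisk, bidisk) where
  toFun p := ⟨((p.1.1 - t) / (1 - t * p.1.1), (p.1.2 - t) / (1 - t * p.1.2)),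
    mem_bidisk.2 ⟨norm_disk_map_lt ht (mem_bidisk.1 p.2).1,
      norm_disk_map_lt ht (mem_bidisk.1 p.2).2⟩⟩
  continuous_toFun := by
    refine Continuous.subtype_mk (Continuous.prodMk ?_ ?_) _
    · exact Continuous.div (by fun_prop) (by fun_prop) fun p =>
        one_sub_mul_ne_zero_of_norm_lt ht (mem_bidisk.1 p.2).1
    · exact Continuous.div (by fun_prop) (by fun_prop) fun p =>
        one_sub_mul_ne_zero_of_norm_lt ht (mem_bidisk.1 p.2).2

theorem isMoebius_transl (t : ℝ) (ht : ‖(t : ℂ)‖ < 1) : IsMoebius (transl t ht) := by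
  have hne : ∀ {z : ℂ}, ‖z‖ < 1 → -(t : ℂ) * z + 1 ≠ 0 := fun {z} hz => by
    have := one_sub_mul_ne_zero_of_norm_lt ht hz
    rwa [neg_mul, add_comm, ← sub_eq_add_neg]
  have hdet : (1 : ℂ) - t * t ≠ 0 := one_sub_mul_ne_zero_of_norm_lt ht ht
  refine isMoebius_of_matrix 1 (-t) (-t) 1 (by simpa using hdet) (fun z hz => ?_) (fun z hz => ?_)
    fun p => ?_
  · rw [mem_ball_zero_iff] at hz ⊢
    refine ⟨hne hz, ?_⟩
    rw [show (1 * z + -(t : ℂ)) / (-t * z + 1) = (z - t) / (1 - t * z) by congr 1 <;> ring]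
    exact norm_disk_map_lt ht hz
  · rw [mem_ball_zero_iff] at hz
    have ht' : ‖((-t : ℝ) : ℂ)‖ < 1 := by simpa using ht
    have h1 := norm_disk_map_lt ht' hz
    have h2 := one_sub_mul_ne_zero_of_norm_lt ht' hz
    refine ⟨_, mem_ball_zero_iff.2 h1, ?_⟩
    rw [eq_div_iff (hne h1)]
    have hx := div_mul_cancel₀ (z - ((-t : ℝ) : ℂ)) h2
    refine mul_right_cancel₀ h2 ?_
    push_cast at hx ⊢
    linear_combination (-(z * t + 1)) * hx
  · have h1 := hne (mem_bidisk.1 p.2).2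
    refine ⟨by rwa [add_comm], Prod.ext ?_ ?_⟩
    · simp only [transl, ContinuousMap.coe_mk]
      congr 1 <;> ring
    · simp only [transl, ContinuousMap.coe_mk]
      congr 1 <;> ring

/-- The coefficients of `(z² - 1) ∂_z F + (w² - 1) ∂_w F`, the derivative at `t = 0` of the
action of the hyperbolic translations on `F`. -/
def lieCoeffs (a : ℕ × ℕ → ℂ) : ℕ × ℕ → ℂ :=
  (mulFst (mulFst (derFst a)) - derFst a) + (mulSnd (mulSnd (derSnd a)) - derSnd a)

theorem AbsConv.lieCoeffs {a : ℕ × ℕ → ℂ} (ha : AbsConv a) : AbsConv (lieCoeffs a) :=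
  (ha.derFst.mulFst.mulFst.sub ha.derFst).add (ha.derSnd.mulSnd.mulSnd.sub ha.derSnd)

theorem ev_lieCoeffs {a : ℕ × ℕ → ℂ} (ha : AbsConv a) {p : ℂ × ℂ} (hp : p ∈ bidisk) :
    ev (lieCoeffs a) p =
      (p.1 ^ 2 - 1) * ev (derFst a) p + (p.2 ^ 2 - 1) * ev (derSnd a) p := by
  rw [lieCoeffs, ev_add (ha.derFst.mulFst.mulFst.sub ha.derFst)
    (ha.derSnd.mulSnd.mulSnd.sub ha.derSnd) hp, ev_sub ha.derFst.mulFst.mulFst ha.derFst hp,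
    ev_sub ha.derSnd.mulSnd.mulSnd ha.derSnd hp, ev_mulFst ha.derFst.mulFst hp,
    ev_mulFst ha.derFst hp, ev_mulSnd ha.derSnd.mulSnd hp, ev_mulSnd ha.derSnd hp]
  ring

theorem hasDerivAt_disk_map (z : ℂ) :
    HasDerivAt (fun t : ℂ => (z - t) / (1 - t * z)) (z ^ 2 - 1) 0 := by
  have h1 : HasDerivAt (fun t : ℂ => z - t) (-1) 0 := by
    simpa using (hasDerivAt_id (0 : ℂ)).const_sub z
  have h2 : HasDerivAt (fun t : ℂ => 1 - t * z) (-z) 0 := by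
    simpa using ((hasDerivAt_id (0 : ℂ)).mul_const z).const_sub 1
  refine (h1.div h2 (by simp)).congr_deriv ?_
  simp
  ring

/-- For small complex `t` the maps `z ↦ (z - t) / (1 - tz)` send a closed disk of radius `r < 1`
into a fixed larger one. -/
theorem norm_disk_map_le {r : ℝ} (h0 : 0 < r) (h1 : r < 1) {t z : ℂ} (ht : ‖t‖ < (1 - r) / 4)
    (hz : ‖z‖ ≤ r) : ‖(z - t) / (1 - t * z)‖ ≤ (1 + r) / 2 := by
  have hn1 : ‖z - t‖ ≤ r + (1 - r) / 4 := (norm_sub_le _ _).trans (by linarith)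
  have hn2 : 1 - (1 - r) / 4 ≤ ‖1 - t * z‖ := by
    have := norm_sub_norm_le (1 : ℂ) (t * z)
    rw [norm_one, norm_mul] at this
    nlinarith [norm_nonneg t, norm_nonneg z]
  rw [norm_div, div_le_iff₀ (by linarith)]
  nlinarith [sq_nonneg (1 - r)]

/-- A closed subspace that is invariant under hyperbolic translations is invariant under their
infinitesimal generator. -/
theorem lie_mem {Y : Submodule ℂ C(bidisk, ℂ)} (hYc : IsClosed (Y : Set C(bidisk, ℂ)))
    (htr : ∀ (t : ℝ) (ht : ‖(t : ℂ)‖ < 1), ∀ F ∈ Y, F.comp (transl t ht) ∈ Y)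
    {F : C(bidisk, ℂ)} (hF : F ∈ Y) {a : ℕ × ℕ → ℂ} (ha : HasCoeffs F a) :
    evMap (lieCoeffs a) ha.1.lieCoeffs ∈ Y := by
  let t : ℕ → ℝ := fun n => 1 / ((n : ℝ) + 2)
  have ht0 : ∀ n, 0 < t n := fun n => by positivity
  have htn : ∀ n, ‖(t n : ℂ)‖ = t n := fun n => by
    rw [norm_real, Real.norm_of_nonneg (ht0 n).le]
  have ht1 : ∀ n, ‖(t n : ℂ)‖ < 1 := fun n => by
    rw [htn, div_lt_one (by positivity)]
    linarith [(Nat.cast_nonneg n : (0 : ℝ) ≤ n)]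
  have htlim : Filter.Tendsto t Filter.atTop (nhds 0) :=
    tendsto_const_nhds.div_atTop
      (Filter.tendsto_atTop_add_const_right _ _ tendsto_natCast_atTop_atTop)
  refine hYc.mem_of_tendsto (b := Filter.atTop)
    (f := fun n => ((t n : ℂ)⁻¹) • (F.comp (transl (t n) (ht1 n)) - F)) ?_
    (Filter.Eventually.of_forall fun n => Y.smul_mem _ (Y.sub_mem (htr _ _ F hF) hF))
  refine tendsto_of_dist_le fun r h0 h1 => ?_
  set s := (1 + r) / 2 with hs
  have hs1 : s < 1 := by linarith
  have hsub : closedBall (0 : ℂ) s ×ˢ closedBall (0 : ℂ) s ⊆ bidisk :=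
    Set.prod_mono (closedBall_subset_ball hs1) (closedBall_subset_ball hs1)
  obtain ⟨M, hM⟩ := ((isCompact_closedBall (0 : ℂ) s).prod
    (isCompact_closedBall (0 : ℂ) s)).exists_bound_of_continuousOn
      ((continuousOn_ev ha.1).mono hsub)
  have hM0 : 0 ≤ M := (norm_nonneg _).trans (hM (0, 0) (by simp; linarith))
  have hε : 0 < (1 - r) / 4 := by linarith
  refine ⟨fun n => 6 * (M + 1) / ((1 - r) / 4) / ((1 - r) / 4) * t n, ?_, ?_⟩
  · simpa using htlim.const_mul (6 * (M + 1) / ((1 - r) / 4) / ((1 - r) / 4))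
  filter_upwards [htlim.eventually (gt_mem_nhds hε)] with n hn p hp1 hp2
  -- For complex `τ` these maps need not be Möbius, but they make `F` along the orbit holomorphic
  -- in `τ`, so the difference quotients are controlled by a bound on `F` alone.
  let c : ℂ → ℂ × ℂ := fun τ =>
    ((p.1.1 - τ) / (1 - τ * p.1.1), (p.1.2 - τ) / (1 - τ * p.1.2))
  have hc0 : c 0 = p.1 := by simp [c]
  have hcm : ∀ τ ∈ ball (0 : ℂ) ((1 - r) / 4),
      c τ ∈ closedBall (0 : ℂ) s ×ˢ closedBall (0 : ℂ) s := fun τ hτ => by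
    rw [mem_ball_zero_iff] at hτ
    exact ⟨mem_closedBall_zero_iff.2 (norm_disk_map_le h0 h1 hτ hp1),
      mem_closedBall_zero_iff.2 (norm_disk_map_le h0 h1 hτ hp2)⟩
  have hdiff : DifferentiableOn ℂ (fun τ => ev a (c τ)) (ball 0 ((1 - r) / 4)) := by
    intro τ hτ
    have hτ' := mem_ball_zero_iff.1 hτ
    have hτ1 : ‖τ‖ < 1 := by linarith
    have hd1 : DifferentiableAt ℂ (fun τ : ℂ => (p.1.1 - τ) / (1 - τ * p.1.1)) τ :=
      DifferentiableAt.fun_div (by fun_prop) (by fun_prop)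
        (one_sub_mul_ne_zero_of_norm_lt hτ1 (mem_bidisk.1 p.2).1)
    have hd2 : DifferentiableAt ℂ (fun τ : ℂ => (p.1.2 - τ) / (1 - τ * p.1.2)) τ :=
      DifferentiableAt.fun_div (by fun_prop) (by fun_prop)
        (one_sub_mul_ne_zero_of_norm_lt hτ1 (mem_bidisk.1 p.2).2)
    exact ((hasFDerivAt_ev ha.1 (hsub (hcm τ hτ))).differentiableAt.comp τ
      (hd1.prodMk hd2)).differentiableWithinAt
  have hderiv : deriv (fun τ => ev a (c τ)) 0 = ev (lieCoeffs a) p := by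
    have h := (hasFDerivAt_ev ha.1 p.2)
    rw [← hc0] at h
    have h' := h.comp_hasDerivAt (0 : ℂ)
      ((hasDerivAt_disk_map p.1.1).prodMk (hasDerivAt_disk_map p.1.2))
    rw [show (fun τ => ev a (c τ)) = ev a ∘ c from rfl, h'.deriv, ev_lieCoeffs ha.1 p.2, hc0]
    simp
  have hle := dist_dslope_le (f := fun τ => ev a (c τ)) (c := 0) (x := (t n : ℂ)) (M := M + 1)
    (by linarith) hdiff (fun τ hτ => (hM _ (hcm τ hτ)).trans_lt (lt_add_one M))
    (by rw [mem_ball_zero_iff, htn]; exact hn)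
  have htne : (t n : ℂ) ≠ 0 := by exact_mod_cast (ht0 n).ne'
  have hval : dslope (fun τ => ev a (c τ)) 0 (t n : ℂ) =
      (((t n : ℂ)⁻¹) • (F.comp (transl (t n) (ht1 n)) - F)) p := by
    rw [dslope_of_ne _ htne, slope_def_field, sub_zero, hc0, ← ha.2 p, div_eq_inv_mul,
      ContinuousMap.smul_apply, ContinuousMap.sub_apply, ContinuousMap.comp_apply,
      ha.2 (transl _ _ p)]
    rfl
  rw [hval, hderiv, dist_zero_right, htn] at hle
  exact hle

theorem lieCoeffs_swap (a : ℕ × ℕ → ℂ) :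
    lieCoeffs (a ∘ Prod.swap) = lieCoeffs a ∘ Prod.swap := by
  funext ⟨j, k⟩
  rcases j with _ | _ | j <;> rcases k with _ | _ | k <;>
    simp [lieCoeffs, mulFst, mulSnd, derFst, derSnd] <;> ring

/-- The generator raises the degree `n ≥ 0` with a factor that vanishes only for
`λ = 4 n (n + 1)`. -/
theorem bd_lieCoeffs_succ {lam : ℂ} {a : ℕ × ℕ → ℂ} (hE : EigenCoeffs lam a) {n : ℕ}
    (h0 : ∀ k ≠ (n : ℤ), bd a k = 0) :
    4 * (n + 1) * bd (lieCoeffs a) (n + 1 : ℕ) = (4 * n * (n + 1) - lam) * bd a n := by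
  have h1 := hE.apply_one_snd n
  have h2 : a (n + 2, 0) = 0 := by
    rw [← bd_natCast a]
    exact h0 _ (by push_cast; omega)
  rw [bd_natCast, bd_natCast]
  rcases n with _ | n
  · simpa [lieCoeffs, mulFst, mulSnd, derFst, derSnd, h2] using h1
  · simp [lieCoeffs, mulFst, mulSnd, derFst, derSnd, h2] at h1 ⊢
    linear_combination -h1

/-- The generator lowers the degree `n + 1 ≥ 1` with a non-zero factor. -/
theorem bd_lieCoeffs_pred {lam : ℂ} {a : ℕ × ℕ → ℂ} (hE : EigenCoeffs lam a) {n : ℕ}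
    (h0 : ∀ k ≠ ((n + 1 : ℕ) : ℤ), bd a k = 0) :
    bd (lieCoeffs a) n = -(n + 1) * bd a (n + 1 : ℕ) := by
  rw [bd_natCast, bd_natCast]
  rcases n with _ | n
  · have h1 : a (0, 1) = 0 := by
      have := h0 (-(1 : ℕ)) (by omega)
      rwa [bd_neg_natCast] at this
    simp [lieCoeffs, mulFst, mulSnd, derFst, derSnd, h1]
  · have h1 := hE.apply_one_snd n
    have h2 : a (n, 0) = 0 := by
      rw [← bd_natCast a]
      exact h0 _ (by push_cast; omega)
    have h3 : a (n + 1, 1) = 0 := by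
      rw [h2] at h1
      simpa [Nat.cast_add_one_ne_zero] using h1
    rcases n with _ | n <;> simp [lieCoeffs, mulFst, mulSnd, derFst, derSnd, h2, h3] <;> ring

/-! ### Poisson Fourier modes -/

/-- The Poisson kernel `((1 - zw) / ((1 - z) (1 - w))) ^ (m + 1)`. -/
def poissonMap (m : ℕ) : C(bidisk, ℂ) where
  toFun p := ((1 - p.1.1 * p.1.2) / ((1 - p.1.1) * (1 - p.1.2))) ^ (m + 1)
  continuous_toFun := by
    refine Continuous.pow (Continuous.div (by fun_prop) (by fun_prop) fun p => ?_) _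
    exact mul_ne_zero (slitPlane_ne_zero (one_sub_mem_slitPlane (mem_bidisk.1 p.2).1))
      (slitPlane_ne_zero (one_sub_mem_slitPlane (mem_bidisk.1 p.2).2))

theorem one_sub_ne_zero_of_mem_ball {z : ℂ} (hz : z ∈ ball (0 : ℂ) 1) : 1 - z ≠ 0 :=
  slitPlane_ne_zero (one_sub_mem_slitPlane (mem_ball_zero_iff.1 hz))

theorem hasDerivAt_poisson {z w : ℂ} (hz : 1 - z ≠ 0) (hw : 1 - w ≠ 0) :
    HasDerivAt (fun w => (1 - z * w) / ((1 - z) * (1 - w))) (1 / (1 - w) ^ 2) w := by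
  have h1 : HasDerivAt (fun w => 1 - z * w) (-z) w := by
    simpa using ((hasDerivAt_id w).const_mul z).const_sub 1
  have h2 : HasDerivAt (fun w => (1 - z) * (1 - w)) (-(1 - z)) w := by
    simpa using ((hasDerivAt_id w).const_sub 1).const_mul (1 - z)
  refine (h1.div h2 (mul_ne_zero hz hw)).congr_deriv ?_
  field_simp
  ring

theorem poissonMap_mem_eigenspace (m : ℕ) : poissonMap m ∈ eigenspace (4 * m * (m + 1)) := by
  have hext : ∀ p ∈ bidisk, extZero (poissonMap m) p =
      ((1 - p.1 * p.2) / ((1 - p.1) * (1 - p.2))) ^ (m + 1) := fun p hp =>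
    extZero_apply _ ⟨p, hp⟩
  constructor
  · intro p hp
    refine DifferentiableWithinAt.congr ?_ hext (hext p hp)
    have hne := mul_ne_zero (one_sub_ne_zero_of_mem_ball hp.1) (one_sub_ne_zero_of_mem_ball hp.2)
    have : DifferentiableAt ℂ (fun p : ℂ × ℂ =>
        ((1 - p.1 * p.2) / ((1 - p.1) * (1 - p.2))) ^ (m + 1)) p := by
      fun_prop (disch := exact hne)
    exact this.differentiableWithinAt
  · rintro ⟨⟨z, w⟩, hp⟩
    have hz := one_sub_ne_zero_of_mem_ball hp.1
    have hw := one_sub_ne_zero_of_mem_ball hp.2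
    rw [invLaplacian_congr hext hp, invLaplacian]
    have hev : (fun z' => deriv (fun w' =>
        ((1 - z' * w') / ((1 - z') * (1 - w'))) ^ (m + 1)) w) =ᶠ[nhds z] fun z' =>
        (m + 1) * ((1 - z' * w) / ((1 - z') * (1 - w))) ^ m * (1 / (1 - w) ^ 2) := by
      filter_upwards [isOpen_ball.mem_nhds hp.1] with z' hz'
      rw [((hasDerivAt_poisson (one_sub_ne_zero_of_mem_ball hz') hw).fun_pow (m + 1)).deriv]
      push_cast
      rfl
    have hd := (((hasDerivAt_poisson hw hz).fun_pow m).const_mul ((m : ℂ) + 1)).mul_const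
      (1 / (1 - w) ^ 2)
    simp only [mul_comm w, mul_comm (1 - w)] at hd
    rw [hev.deriv_eq, hd.deriv]
    simp only [poissonMap, ContinuousMap.coe_mk]
    rcases m with _ | m
    · simp
    · rw [Nat.add_sub_cancel, pow_succ _ (m + 1), pow_succ _ m]
      generalize ((1 - z * w) / ((1 - z) * (1 - w))) ^ m = E
      field_simp

/-- The form `c / (1 - w)^(m + 1)` is preserved by differentiation, with `c` and `m` changing, so
every coefficient follows from the constant one. -/
theorem coeff_ne_zero_of_one_sub_pow {a : ℕ × ℕ → ℂ} (ha : AbsConv a) {m : ℕ} {c : ℂ}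
    (hc : c ≠ 0) (h : ∀ w ∈ ball (0 : ℂ) 1, ev a (0, w) = c * (1 / (1 - w)) ^ (m + 1)) (k : ℕ) :
    a (0, k) ≠ 0 := by
  induction k generalizing a m c with
  | zero =>
    have h0 := h 0 (by simp)
    rw [ev, tsum_eq_single (0, 0)] at h0
    · simp at h0
      rwa [h0]
    · rintro ⟨j, k⟩ hjk
      cases j <;> cases k <;> simp_all
  | succ k ih =>
    have hd : ∀ w ∈ ball (0 : ℂ) 1,
        ev (derSnd a) (0, w) = c * (m + 1) * (1 / (1 - w)) ^ (m + 1 + 1) := by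
      intro w hw
      have hne := one_sub_ne_zero_of_mem_ball hw
      have hev : (fun w => ev a (0, w)) =ᶠ[nhds w] fun w => c * (1 / (1 - w)) ^ (m + 1) := by
        filter_upwards [isOpen_ball.mem_nhds hw] with w' hw' using h w' hw'
      have h1 : HasDerivAt (fun w : ℂ => 1 / (1 - w)) (1 / (1 - w) ^ 2) w := by
        simpa using hasDerivAt_poisson (z := 0) (by simp) hne
      rw [← (hasDerivAt_ev_snd ha ⟨by simp, hw⟩).deriv, hev.deriv_eq,
        ((h1.fun_pow (m + 1)).const_mul c).deriv]
      push_cast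
      generalize 1 - w = d
      ring
    exact right_ne_zero_of_mul
      (ih ha.derSnd (mul_ne_zero hc (Nat.cast_add_one_ne_zero m)) hd)

theorem bd_poissonMap_ne_zero {m : ℕ} {a : ℕ × ℕ → ℂ} (ha : HasCoeffs (poissonMap m) a) (n : ℤ) :
    bd a n ≠ 0 := by
  have hswap : (poissonMap m).comp bidiskSwap = poissonMap m := by
    ext p
    simp only [poissonMap, bidiskSwap, ContinuousMap.comp_apply, ContinuousMap.coe_mk]
    rw [mul_comm p.1.2, mul_comm (1 - p.1.2)]
  have hsym : a ∘ Prod.swap = a := by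
    have := ha.swap
    rw [hswap] at this
    exact this.unique ha
  have key : ∀ k : ℕ, bd a (-k) ≠ 0 := by
    intro k
    rw [bd_neg_natCast]
    refine coeff_ne_zero_of_one_sub_pow ha.1 (m := m) one_ne_zero (fun w hw => ?_) k
    rw [← ha.2 ⟨(0, w), by simp, hw⟩]
    simp [poissonMap]
  obtain ⟨k, rfl | rfl⟩ := n.eq_nat_or_neg
  · rw [← hsym, bd_swap]
    exact key k
  · exact key k

theorem integral_exp_int (k : ℤ) :
    ∫ t in (0 : ℝ)..(2 * Real.pi), exp (-(I * k * t)) = if k = 0 then 2 * Real.pi else 0 := by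
  split_ifs with hk
  · simp [hk]
  · have hc : -(I * k) ≠ 0 := by simp [hk]
    have h1 : exp (-(I * k) * (2 * Real.pi : ℝ)) = 1 := by
      rw [Complex.exp_eq_one_iff]
      exact ⟨-k, by push_cast; ring⟩
    have h2 := integral_exp_mul_complex (a := 0) (b := 2 * Real.pi) hc
    rw [h1] at h2
    simpa [neg_mul] using h2

/-- The Poisson Fourier mode `P_n^{m+1}` is the component of degree `-n` of the Poisson kernel. -/
theorem hasCoeffs_pfm {m : ℕ} {a : ℕ × ℕ → ℂ} (ha : HasCoeffs (poissonMap m) a) (n : ℤ) :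
    HasCoeffs (pfm (m + 1) n) (twist (deltaAt (-n)) a) := by
  refine ⟨ha.1.twist (norm_deltaAt_le _), fun p => ?_⟩
  have hω : ∀ t : ℝ, ‖exp (-(I * t))‖ = 1 := fun t => by rw [norm_exp]; simp
  have hint : ∀ t : ℝ, (1 - p.1.1 * p.1.2) ^ (m + 1) * (exp (-(I * n * t)) /
      ((1 - p.1.1 * exp (-(I * t))) ^ (m + 1) * (1 - p.1.2 * exp (I * t)) ^ (m + 1))) =
      exp (-(I * n * t)) * poissonMap m (rot _ (hω t) p) := by
    intro t
    simp only [poissonMap, rot, ContinuousMap.coe_mk, ← exp_neg, neg_neg]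
    have h1 : exp (-(I * t)) * p.1.1 * (exp (I * t) * p.1.2) = p.1.1 * p.1.2 := by
      have : exp (-(I * t)) * exp (I * t) = 1 := by rw [← exp_add]; simp
      linear_combination p.1.1 * p.1.2 * this
    rw [h1, div_pow, mul_pow, mul_comm (exp _) p.1.1, mul_comm (exp _) p.1.2]
    ring
  let f : ℕ × ℕ → ℝ → ℂ := fun i t =>
    a i * (p.1.1 ^ i.1 * p.1.2 ^ i.2) * exp (-(I * (n + i.1 - i.2 : ℤ) * t))
  have hfn : ∀ i t, ‖f i t‖ = ‖a i * (p.1.1 ^ i.1 * p.1.2 ^ i.2)‖ := fun i t => by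
    simp only [f]
    rw [norm_mul _ (exp _), norm_exp]
    simp
  have hfsum : ∀ t, HasSum (fun i => f i t)
      (exp (-(I * n * t)) * poissonMap m (rot _ (hω t) p)) := by
    intro t
    have h := (ha.rot (hω t)).1.hasSum p.2
    rw [← (ha.rot (hω t)).2 p] at h
    refine (h.mul_left (exp (-(I * n * t)))).congr_fun fun i => ?_
    simp only [f, twist, ← exp_int_mul]
    have he : exp (-(I * (n + i.1 - i.2 : ℤ) * t)) =
        exp (-(I * n * t)) * exp (((i.1 : ℤ) - i.2 : ℤ) * -(I * t)) := by
      rw [← exp_add]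
      congr 1
      push_cast
      ring
    rw [he]
    ring
  have hI := intervalIntegral.hasSum_integral_of_dominated_convergence (μ := volume)
    (a := 0) (b := 2 * Real.pi) (F := f)
    (f := fun t => exp (-(I * n * t)) * poissonMap m (rot _ (hω t) p))
    (fun i _ => ‖a i * (p.1.1 ^ i.1 * p.1.2 ^ i.2)‖)
    (fun i => by
      have : Continuous (f i) := by fun_prop
      exact this.aestronglyMeasurable)
    (fun i => Filter.Eventually.of_forall fun t _ => (hfn i t).le)
    (Filter.Eventually.of_forall fun t _ => (ha.1.summable p.2).norm)
    intervalIntegrable_const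
    (Filter.Eventually.of_forall fun t _ => hfsum t)
  have hfi : ∀ i, ∫ t in (0 : ℝ)..(2 * Real.pi), f i t =
      2 * Real.pi * (twist (deltaAt (-n)) a i * (p.1.1 ^ i.1 * p.1.2 ^ i.2)) := by
    intro i
    simp only [f]
    rw [intervalIntegral.integral_const_mul, integral_exp_int]
    have : n + i.1 - i.2 = 0 ↔ (i.1 : ℤ) - i.2 = -n := by omega
    simp only [twist, deltaAt, this]
    split_ifs
    · simp
      ring
    · simp
  have hpi : (2 * Real.pi : ℂ) ≠ 0 := by simp [Real.pi_ne_zero]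
  have hval : pfm (m + 1) n p = (2 * Real.pi : ℂ)⁻¹ *
      ∫ t in (0 : ℝ)..(2 * Real.pi), exp (-(I * n * t)) * poissonMap m (rot _ (hω t) p) := by
    simp only [← hint]
    rw [intervalIntegral.integral_const_mul]
    have hc : ((m : ℂ) + 1) = ((m + 1 : ℕ) : ℂ) := by push_cast; rfl
    simp only [pfm, pfmFun, ContinuousMap.coe_mk, hc, cpow_natCast]
    ring
  rw [hval, ← hI.tsum_eq]
  simp only [hfi]
  rw [tsum_mul_left, inv_mul_cancel_left₀ hpi]
  rfl

theorem isMode_pfm (m : ℕ) (n : ℤ) : IsMode (4 * m * (m + 1)) (-n) (pfm (m + 1) n) := by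
  obtain ⟨a, ha, hE⟩ := exists_of_mem_eigenspace (poissonMap_mem_eigenspace m)
  refine ⟨_, hasCoeffs_pfm ha n, hE.twist _, fun k hk => ?_, ?_⟩
  · simp [bd_twist, deltaAt, hk]
  · simpa [bd_twist, deltaAt] using bd_poissonMap_ne_zero ha (-n)

/-! ### Degrees occurring in Möbius invariant subspaces -/

namespace IsMoebiusInvariant

variable {lam : ℂ} {Y : Submodule ℂ C(bidisk, ℂ)}

theorem eq_modeSpace (hY : IsMoebiusInvariant lam Y) : Y = modeSpace lam (modeSet Y) :=
  _root_.eq_modeSpace hY.le_eigenspace hY.isClosed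
    fun ω hω => hY.comp_mem _ (isMoebius_rot ω hω)

theorem exists_isMode (hY : IsMoebiusInvariant lam Y) {n : ℤ} (hn : n ∈ modeSet Y) :
    ∃ G ∈ Y, IsMode lam n G :=
  _root_.exists_isMode hY.le_eigenspace hY.isClosed
    (fun ω hω => hY.comp_mem _ (isMoebius_rot ω hω)) hn

theorem lie_mem (hY : IsMoebiusInvariant lam Y) {F : C(bidisk, ℂ)} (hF : F ∈ Y)
    {a : ℕ × ℕ → ℂ} (ha : HasCoeffs F a) : evMap (lieCoeffs a) ha.1.lieCoeffs ∈ Y :=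
  _root_.lie_mem hY.isClosed (fun t ht => hY.comp_mem _ (isMoebius_transl t ht)) hF ha

theorem pred_mem (hY : IsMoebiusInvariant lam Y) {n : ℕ} (hn : ((n + 1 : ℕ) : ℤ) ∈ modeSet Y) :
    (n : ℤ) ∈ modeSet Y := by
  obtain ⟨G, hG, b, hb, hE, h0, hbn⟩ := hY.exists_isMode hn
  refine ⟨_, hY.lie_mem hG hb, _, hasCoeffs_evMap _, ?_⟩
  rw [bd_lieCoeffs_pred hE h0]
  exact mul_ne_zero (neg_ne_zero.2 (Nat.cast_add_one_ne_zero n)) hbn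

theorem succ_mem (hY : IsMoebiusInvariant lam Y) {n : ℕ} (hl : lam ≠ 4 * n * (n + 1))
    (hn : (n : ℤ) ∈ modeSet Y) : ((n + 1 : ℕ) : ℤ) ∈ modeSet Y := by
  obtain ⟨G, hG, b, hb, hE, h0, hbn⟩ := hY.exists_isMode hn
  refine ⟨_, hY.lie_mem hG hb, _, hasCoeffs_evMap _, fun h => ?_⟩
  have := bd_lieCoeffs_succ hE h0
  rw [h, mul_zero] at this
  exact mul_ne_zero (sub_ne_zero.2 hl.symm) hbn this.symm

theorem neg_pred_mem (hY : IsMoebiusInvariant lam Y) {n : ℕ}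
    (hn : -((n + 1 : ℕ) : ℤ) ∈ modeSet Y) : -(n : ℤ) ∈ modeSet Y := by
  obtain ⟨G, hG, b, hb, hE, h0, hbn⟩ := hY.exists_isMode hn
  refine ⟨_, hY.lie_mem hG hb, _, hasCoeffs_evMap _, ?_⟩
  rw [← bd_swap, ← lieCoeffs_swap, bd_lieCoeffs_pred hE.swap, bd_swap]
  · exact mul_ne_zero (neg_ne_zero.2 (Nat.cast_add_one_ne_zero n)) hbn
  · intro k hk
    rw [bd_swap]
    exact h0 _ (by omega)

theorem neg_succ_mem (hY : IsMoebiusInvariant lam Y) {n : ℕ} (hl : lam ≠ 4 * n * (n + 1))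
    (hn : -(n : ℤ) ∈ modeSet Y) : -((n + 1 : ℕ) : ℤ) ∈ modeSet Y := by
  obtain ⟨G, hG, b, hb, hE, h0, hbn⟩ := hY.exists_isMode hn
  refine ⟨_, hY.lie_mem hG hb, _, hasCoeffs_evMap _, fun h => ?_⟩
  have := bd_lieCoeffs_succ hE.swap (n := n) fun k hk => by
    rw [bd_swap]
    exact h0 _ (by omega)
  rw [lieCoeffs_swap, bd_swap, h, mul_zero, bd_swap] at this
  exact mul_ne_zero (sub_ne_zero.2 hl.symm) hbn this.symm

theorem zero_mem (hY : IsMoebiusInvariant lam Y) (hne : (modeSet Y).Nonempty) :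
    0 ∈ modeSet Y := by
  obtain ⟨n, hn⟩ := hne
  obtain ⟨k, rfl | rfl⟩ := n.eq_nat_or_neg
  · induction k with
    | zero => simpa using hn
    | succ k ih => exact ih (hY.pred_mem hn)
  · induction k with
    | zero => simpa using hn
    | succ k ih => exact ih (hY.neg_pred_mem hn)

end IsMoebiusInvariant

theorem eq_univ_of_succ_mem {A : Set ℕ} (h0 : 0 ∈ A) (hs : ∀ n ∈ A, n + 1 ∈ A) : A = Set.univ :=
  Set.eq_univ_of_forall fun n => Nat.rec h0 (fun n hn => hs n hn) n

theorem eq_Iic_or_univ {A : Set ℕ} {m : ℕ} (h0 : 0 ∈ A) (hp : ∀ n, n + 1 ∈ A → n ∈ A)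
    (hs : ∀ n, n ≠ m → n ∈ A → n + 1 ∈ A) : A = Set.Iic m ∨ A = Set.univ := by
  by_cases hm : m + 1 ∈ A
  · refine .inr (eq_univ_of_succ_mem h0 fun n hn => ?_)
    by_cases hnm : n = m
    · rwa [hnm]
    · exact hs n hnm hn
  · left
    ext n
    constructor
    · intro hn
      by_contra hlt
      rw [Set.mem_Iic, not_le] at hlt
      induction n, hlt using Nat.le_induction with
      | base => exact hm hn
      | succ n _ ih => exact ih (hp n hn)
    · intro hn
      induction n with
      | zero => exact h0
      | succ n ih =>
        rw [Set.mem_Iic] at hn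
        exact hs n (by omega) (ih (Set.mem_Iic.2 (by omega)))

theorem eigenvalue_injective {m n : ℕ} (h : n ≠ m) :
    (4 * m * (m + 1) : ℂ) ≠ 4 * n * (n + 1) := by
  intro he
  have he' : 4 * m * (m + 1) = 4 * n * (n + 1) := by exact_mod_cast he
  rcases lt_or_gt_of_ne h with h | h <;> nlinarith

theorem modeSet_eq_univ {lam : ℂ} {Y : Submodule ℂ C(bidisk, ℂ)} (hY : IsMoebiusInvariant lam Y)
    (hl : ∀ m : ℕ, lam ≠ 4 * m * (m + 1)) (hne : (modeSet Y).Nonempty) :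
    modeSet Y = Set.univ := by
  have h0 := hY.zero_mem hne
  have h1 := eq_univ_of_succ_mem (A := {n : ℕ | (n : ℤ) ∈ modeSet Y}) h0
    fun n hn => hY.succ_mem (hl n) hn
  have h2 := eq_univ_of_succ_mem (A := {n : ℕ | -(n : ℤ) ∈ modeSet Y}) (by simpa using h0)
    fun n hn => hY.neg_succ_mem (hl n) hn
  refine Set.eq_univ_of_forall fun n => ?_
  obtain ⟨k, rfl | rfl⟩ := n.eq_nat_or_neg
  · exact Set.eq_univ_iff_forall.1 h1 k
  · exact Set.eq_univ_iff_forall.1 h2 k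

/-- For `λ = 4 m (m + 1)` the set of degrees is closed under all steps `n ↦ n ± 1` except possibly
`m ↦ m + 1` and `-m ↦ -m - 1`. -/
theorem modeSet_cases {m : ℕ} {Y : Submodule ℂ C(bidisk, ℂ)}
    (hY : IsMoebiusInvariant (4 * m * (m + 1)) Y) (hne : (modeSet Y).Nonempty) :
    modeSet Y = Set.Iic (m : ℤ) ∨ modeSet Y = Set.Ici (-(m : ℤ)) ∨
      modeSet Y = Set.Icc (-(m : ℤ)) m ∨ modeSet Y = Set.univ := by
  have h0 := hY.zero_mem hne
  have h1 := eq_Iic_or_univ (A := {n : ℕ | (n : ℤ) ∈ modeSet Y}) (m := m) h0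
    (fun n hn => hY.pred_mem hn) fun n hnm hn => hY.succ_mem (eigenvalue_injective hnm) hn
  have h2 := eq_Iic_or_univ (A := {n : ℕ | -(n : ℤ) ∈ modeSet Y}) (m := m) (by simpa using h0)
    (fun n hn => hY.neg_pred_mem hn) fun n hnm hn => hY.neg_succ_mem (eigenvalue_injective hnm) hn
  have hcase : ∀ {S : Set ℤ}, (∀ k : ℕ, (k : ℤ) ∈ modeSet Y ↔ (k : ℤ) ∈ S) →
      (∀ k : ℕ, -(k : ℤ) ∈ modeSet Y ↔ -(k : ℤ) ∈ S) → modeSet Y = S := by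
    intro S hS1 hS2
    ext n
    obtain ⟨k, rfl | rfl⟩ := n.eq_nat_or_neg
    · exact hS1 k
    · exact hS2 k
  rcases h1 with h1 | h1 <;> rcases h2 with h2 | h2 <;> simp only [Set.ext_iff] at h1 h2
  · refine .inr (.inr (.inl (hcase (fun k => (h1 k).trans ?_) fun k => (h2 k).trans ?_))) <;>
      simp only [Set.mem_Iic, Set.mem_Icc] <;> omega
  · refine .inl (hcase (fun k => (h1 k).trans ?_) fun k => (h2 k).trans ?_) <;>
      simp only [Set.mem_Iic, Set.mem_univ, true_iff] <;> omega
  · refine .inr (.inl (hcase (fun k => (h1 k).trans ?_) fun k => (h2 k).trans ?_)) <;>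
      simp only [Set.mem_Iic, Set.mem_Ici, Set.mem_univ, true_iff] <;> omega
  · exact .inr (.inr (.inr (hcase (fun k => (h1 k).trans (by simp)) fun k =>
      (h2 k).trans (by simp))))

/-! ### Invariance of the exceptional subspaces -/

theorem isMoebiusInvariant_inf_growthSpace (lam : ℂ) (m : ℕ) :
    IsMoebiusInvariant lam (eigenspace lam ⊓ growthSpace m) where
  le_eigenspace := inf_le_left
  isClosed := (isClosed_eigenspace lam).inter (isClosed_growthSpace m)
  comp_mem _ hT _ hF := ⟨eigenspace_comp_mem hF.1 hT.isFractionalMap,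
    growthSpace_comp_mem hF.2 hT.isFractionalMap⟩

/-- The degrees at most `m` are those of the eigenfunctions in `growthSpace m`: by the
classification, it suffices to exhibit one such eigenfunction with all degrees `n ≤ 0`. -/
theorem modeSpace_Iic_eq (m : ℕ) : modeSpace (4 * m * (m + 1)) (Set.Iic (m : ℤ)) =
    eigenspace (4 * m * (m + 1)) ⊓ growthSpace m := by
  have hY := isMoebiusInvariant_inf_growthSpace (4 * m * (m + 1)) m
  have hneg : ∀ k : ℕ, -(k : ℤ) ∈ modeSet (eigenspace (4 * m * (m + 1)) ⊓ growthSpace m) := by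
    intro k
    obtain ⟨a, ha, -⟩ := exists_of_mem_eigenspace (besselMap_mem_eigenspace m)
    exact ⟨_, ⟨besselMap_mem_eigenspace m, besselMap_mem_growthSpace m⟩, a, ha,
      bd_besselMap_ne_zero m ha k⟩
  have hpos : ∀ n ∈ modeSet (eigenspace (4 * m * (m + 1)) ⊓ growthSpace m), n ≤ (m : ℤ) := by
    rintro n ⟨F, hF, a, ha, hn⟩
    by_contra h
    exact hn (bd_eq_zero_of_mem_growthSpace hF.2 ha (not_le.1 h))
  have hset := modeSet_cases hY ⟨_, hneg 0⟩
  rw [hY.eq_modeSpace]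
  rcases hset with h | h | h | h
  · rw [h]
  · have := h ▸ hneg (m + 1)
    rw [Set.mem_Ici] at this
    omega
  · have := h ▸ hneg (m + 1)
    rw [Set.mem_Icc] at this
    omega
  · have := hpos (m + 1) (h ▸ Set.mem_univ _)
    omega

theorem isMoebiusInvariant_Iic (m : ℕ) :
    IsMoebiusInvariant (4 * m * (m + 1)) (modeSpace (4 * m * (m + 1)) (Set.Iic (m : ℤ))) := by
  rw [modeSpace_Iic_eq]
  exact isMoebiusInvariant_inf_growthSpace _ m

theorem comp_swap_swap (F : C(bidisk, ℂ)) : (F.comp bidiskSwap).comp bidiskSwap = F := rfl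

theorem mem_modeSpace_iff_swap {lam : ℂ} {S : Set ℤ} {F : C(bidisk, ℂ)} :
    F ∈ modeSpace lam S ↔ F.comp bidiskSwap ∈ modeSpace lam (-S) := by
  refine ⟨mem_modeSpace_swap, fun h => ?_⟩
  have := mem_modeSpace_swap h
  rwa [comp_swap_swap, neg_neg] at this

theorem isMoebiusInvariant_Ici (m : ℕ) :
    IsMoebiusInvariant (4 * m * (m + 1)) (modeSpace (4 * m * (m + 1)) (Set.Ici (-(m : ℤ)))) := by
  have hmem : ∀ F, F ∈ modeSpace (4 * m * (m + 1)) (Set.Ici (-(m : ℤ))) ↔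
      F.comp bidiskSwap ∈ eigenspace (4 * m * (m + 1)) ⊓ growthSpace m := fun F => by
    rw [mem_modeSpace_iff_swap, ← modeSpace_Iic_eq, Set.neg_Ici, neg_neg]
  refine ⟨modeSpace_le_eigenspace _ _, ?_, fun T hT F hF => ?_⟩
  · have hc : Continuous fun F : C(bidisk, ℂ) => F.comp bidiskSwap :=
      ContinuousMap.continuous_precomp _
    have := (isMoebiusInvariant_inf_growthSpace (4 * m * (m + 1)) m).isClosed.preimage hc
    convert this using 1
    ext F
    exact hmem F
  · rw [hmem] at hF ⊢
    -- The swapped map is fractional linear as well.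
    have hT' := hT.isFractionalMap.conj_swap
    exact ⟨eigenspace_comp_mem hF.1 hT', growthSpace_comp_mem hF.2 hT'⟩

theorem isMoebiusInvariant_Icc (m : ℕ) :
    IsMoebiusInvariant (4 * m * (m + 1)) (modeSpace (4 * m * (m + 1)) (Set.Icc (-(m : ℤ)) m)) := by
  rw [← Set.Ici_inter_Iic, modeSpace_inter]
  exact ⟨inf_le_left.trans (modeSpace_le_eigenspace _ _),
    (isMoebiusInvariant_Ici m).isClosed.inter (isMoebiusInvariant_Iic m).isClosed,
    fun T hT F hF => ⟨(isMoebiusInvariant_Ici m).comp_mem T hT F hF.1,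
      (isMoebiusInvariant_Iic m).comp_mem T hT F hF.2⟩⟩

theorem pfm_mem_modeSpace_iff {m : ℕ} {n : ℤ} {S : Set ℤ} :
    pfm (m + 1) n ∈ modeSpace (4 * m * (m + 1)) S ↔ -n ∈ S := by
  obtain ⟨b, hb, hE, h0, hn⟩ := isMode_pfm m n
  rw [hb.mem_modeSpace_iff]
  constructor
  · rintro ⟨-, h⟩
    by_contra hS
    exact hn (h _ hS)
  · refine fun hS => ⟨hE, fun k hk => h0 k ?_⟩
    rintro rfl
    exact hk hS

theorem modeSpace_injective (m : ℕ) : Function.Injective (modeSpace (4 * m * (m + 1))) := by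
  intro S T h
  ext n
  rw [← neg_neg n, ← pfm_mem_modeSpace_iff (m := m), h, pfm_mem_modeSpace_iff]

theorem Xplus_eq (m : ℕ) : Xplus m = modeSpace (4 * m * (m + 1)) (Set.Iic (m : ℤ)) := by
  refine le_antisymm (Submodule.topologicalClosure_minimal _ (Submodule.span_le.2 ?_)
    (isMoebiusInvariant_Iic m).isClosed)
    (modeSpace_le (Submodule.isClosed_topologicalClosure _) fun n hn => ?_)
  · rintro _ ⟨n, hn, rfl⟩
    exact pfm_mem_modeSpace_iff.2 (Set.mem_Iic.2 (by omega))
  · refine ⟨pfm (m + 1) (-n), Submodule.le_topologicalClosure _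
      (Submodule.subset_span ⟨-n, neg_le_neg hn, rfl⟩), ?_⟩
    simpa using isMode_pfm m (-n)

theorem Xminus_eq (m : ℕ) : Xminus m = modeSpace (4 * m * (m + 1)) (Set.Ici (-(m : ℤ))) := by
  refine le_antisymm (Submodule.topologicalClosure_minimal _ (Submodule.span_le.2 ?_)
    (isMoebiusInvariant_Ici m).isClosed)
    (modeSpace_le (Submodule.isClosed_topologicalClosure _) fun n hn => ?_)
  · rintro _ ⟨n, hn, rfl⟩
    exact pfm_mem_modeSpace_iff.2 (Set.mem_Ici.2 (by omega))
  · refine ⟨pfm (m + 1) (-n), Submodule.le_topologicalClosure _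
      (Submodule.subset_span ⟨-n, neg_le.2 hn, rfl⟩), ?_⟩
    simpa using isMode_pfm m (-n)

theorem Xzero_eq_span_image (m : ℕ) :
    Xzero m = Submodule.span ℂ (Set.range fun n : Finset.Icc (-(m : ℤ)) m => pfm (m + 1) n) := by
  rw [Xzero]
  congr 1
  ext F
  constructor
  · rintro ⟨n, h1, h2, rfl⟩
    exact ⟨⟨n, Finset.mem_Icc.2 ⟨h1, h2⟩⟩, rfl⟩
  · rintro ⟨⟨n, hn⟩, rfl⟩
    exact ⟨n, (Finset.mem_Icc.1 hn).1, (Finset.mem_Icc.1 hn).2, rfl⟩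

theorem Xzero_eq (m : ℕ) : Xzero m = modeSpace (4 * m * (m + 1)) (Set.Icc (-(m : ℤ)) m) := by
  have hfin : FiniteDimensional ℂ (Xzero m) := by
    rw [Xzero_eq_span_image]
    exact FiniteDimensional.span_of_finite ℂ (Set.finite_range _)
  refine le_antisymm (Submodule.span_le.2 ?_)
    (modeSpace_le (Submodule.closed_of_finiteDimensional _) fun n hn => ?_)
  · rintro _ ⟨n, h1, h2, rfl⟩
    exact pfm_mem_modeSpace_iff.2 (Set.mem_Icc.2 ⟨by omega, by omega⟩)
  · refine ⟨pfm (m + 1) (-n), Submodule.subset_span ⟨-n, neg_le_neg hn.2, neg_le.2 hn.1, rfl⟩, ?_⟩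
    simpa using isMode_pfm m (-n)

/-! ### Dimensions and the classification -/

theorem linearIndependent_pfm (m : ℕ) : LinearIndependent ℂ fun n : ℤ => pfm (m + 1) n := by
  rw [linearIndependent_iff']
  intro s g hg i hi
  choose b hb hE h0 hn using isMode_pfm m
  have hsum := HasCoeffs.sum s fun n _ => (hb n).smul (g n)
  rw [hg] at hsum
  have h := congrFun (hsum.unique .zero) ((-i).toNat, (- -i).toNat)
  rw [Finset.sum_apply, Finset.sum_eq_single i] at h
  · exact (mul_eq_zero.1 h).resolve_right (hn i)
  · intro n _ hni
    exact mul_eq_zero_of_right _ (h0 n (-i) (by omega))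
  · exact fun h => absurd hi h

theorem not_finiteDimensional_of_pfm_mem {m : ℕ} {Y : Submodule ℂ C(bidisk, ℂ)} (f : ℕ → ℤ)
    (hf : Function.Injective f) (h : ∀ k, pfm (m + 1) (f k) ∈ Y) : ¬ FiniteDimensional ℂ Y := by
  intro hfin
  have hli : LinearIndependent ℂ fun k : ℕ => (⟨pfm (m + 1) (f k), h k⟩ : Y) :=
    LinearIndependent.of_comp Y.subtype ((linearIndependent_pfm m).comp f hf)
  have := hli.finite
  exact not_finite ℕ

theorem nontrivialInvariantSubspaces_eq (m : ℕ) :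
    nontrivialInvariantSubspaces (4 * m * (m + 1)) = {Xplus m, Xminus m, Xzero m} := by
  rw [Xplus_eq, Xminus_eq, Xzero_eq]
  have hne : ∀ {S : Set ℤ}, 0 ∈ S → modeSpace (4 * m * (m + 1)) S ≠ ⊥ := fun {S} h0 h => by
    rw [← modeSpace_empty (4 * m * (m + 1))] at h
    exact Set.notMem_empty _ (modeSpace_injective m h ▸ h0)
  have hne' : ∀ {S : Set ℤ} (n : ℤ), n ∉ S →
      modeSpace (4 * m * (m + 1)) S ≠ eigenspace (4 * m * (m + 1)) := fun {S} n hn h => by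
    rw [← modeSpace_univ] at h
    exact hn (modeSpace_injective m h ▸ Set.mem_univ n)
  ext Y
  constructor
  · rintro ⟨hY, hbot, htop⟩
    have heq := hY.eq_modeSpace
    have hnon : (modeSet Y).Nonempty := by
      rw [Set.nonempty_iff_ne_empty]
      intro h
      rw [h, modeSpace_empty] at heq
      exact hbot heq
    rcases modeSet_cases hY hnon with h | h | h | h <;> rw [h] at heq
    · exact .inl heq
    · exact .inr (.inl heq)
    · exact .inr (.inr heq)
    · rw [modeSpace_univ] at heq
      exact absurd heq htop
  · rintro (rfl | rfl | rfl)
    · exact ⟨isMoebiusInvariant_Iic m, hne (by simp), hne' (m + 1) (by simp)⟩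
    · exact ⟨isMoebiusInvariant_Ici m, hne (by simp), hne' (-m - 1) (by simp)⟩
    · exact ⟨isMoebiusInvariant_Icc m, hne (by simp), hne' (m + 1) (by simp)⟩

theorem ncard_nontrivialInvariantSubspaces (m : ℕ) :
    (nontrivialInvariantSubspaces (4 * m * (m + 1))).ncard = 3 := by
  rw [nontrivialInvariantSubspaces_eq, Set.ncard_eq_three]
  refine ⟨_, _, _, ?_, ?_, ?_, rfl⟩ <;> simp only [Xplus_eq, Xminus_eq, Xzero_eq] <;> intro h <;>
    have h := Set.ext_iff.1 (modeSpace_injective m h)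
  · have := h (m + 1)
    simp only [Set.mem_Iic, Set.mem_Ici] at this
    omega
  · have := h (-m - 1)
    simp only [Set.mem_Iic, Set.mem_Icc] at this
    omega
  · have := h (m + 1)
    simp only [Set.mem_Ici, Set.mem_Icc] at this
    omega

theorem finrank_Xzero (m : ℕ) : Module.finrank ℂ (Xzero m) = 2 * m + 1 := by
  have h : LinearIndependent ℂ fun n : Finset.Icc (-(m : ℤ)) m => pfm (m + 1) n :=
    (linearIndependent_pfm m).comp _ Subtype.val_injective
  rw [Xzero_eq_span_image, finrank_span_eq_card h, Fintype.card_coe, Int.card_Icc]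
  omega

end

theorem mainTheorem2 (lam : ℂ) :
    ((∀ m : ℕ, lam ≠ 4 * m * (m + 1)) → nontrivialInvariantSubspaces lam = ∅) ∧
    (∀ m : ℕ, lam = 4 * m * (m + 1) →
      nontrivialInvariantSubspaces lam = {Xplus m, Xminus m, Xzero m} ∧
      (nontrivialInvariantSubspaces lam).ncard = 3 ∧
      Module.finrank ℂ (Xzero m) = 2 * m + 1 ∧
      ¬ FiniteDimensional ℂ (Xplus m) ∧
      ¬ FiniteDimensional ℂ (Xminus m) ∧
      (∀ F : C(bidisk, ℂ), F ∈ Xzero m ↔ F.comp bidiskSwap ∈ Xzero m) ∧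
      (∀ F : C(bidisk, ℂ), F ∈ Xplus m ↔ F.comp bidiskSwap ∈ Xminus m)) := by
  constructor
  · intro hl
    refine Set.eq_empty_iff_forall_notMem.2 ?_
    rintro Y ⟨hY, hbot, htop⟩
    have heq := hY.eq_modeSpace
    rcases (modeSet Y).eq_empty_or_nonempty with h | h
    · rw [h, modeSpace_empty] at heq
      exact hbot heq
    · rw [modeSet_eq_univ hY hl h, modeSpace_univ] at heq
      exact htop heq
  · rintro m rfl
    refine ⟨nontrivialInvariantSubspaces_eq m, ncard_nontrivialInvariantSubspaces m,
      finrank_Xzero m, ?_, ?_, fun F => ?_, fun F => ?_⟩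
    · refine not_finiteDimensional_of_pfm_mem (m := m) (fun k => (k : ℤ)) Nat.cast_injective
        fun k => ?_
      rw [Xplus_eq, pfm_mem_modeSpace_iff, Set.mem_Iic]
      omega
    · refine not_finiteDimensional_of_pfm_mem (m := m) (fun k => -(k : ℤ))
        (neg_injective.comp Nat.cast_injective) fun k => ?_
      rw [Xminus_eq, pfm_mem_modeSpace_iff, Set.mem_Ici]
      omega
    · rw [Xzero_eq, mem_modeSpace_iff_swap, Set.neg_Icc, neg_neg]
    · rw [Xplus_eq, Xminus_eq, mem_modeSpace_iff_swap, Set.neg_Iic]
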